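/- Let $\mathbf{X}$ be the five-element poset $\{a,b,c,d,e\}$ with $a,b<c<d,e$, in which $a,b$ are incomparable and $d,e$ are incomparable. A poset is $\mathbf{X}$-free if it has no induced subposet isomorphic to $\mathbf{X}$. For a finite poset $P$, let the order polytope be $$\mathcal{O}(P)=\{x\in\mathbb{R}^P : 0\le x_p\le 1 \text{ for all } p\in P,\ x_p\le x_q \text{ if } p\le q\}$$ and the chain polytope $$\mathcal{C}(P)=\{x\in\mathbb{R}^P : x_p\ge 0 \text{ for all } p\in P,\ x_{p_1}+\cdots+x_{p_m}\le 1 \text{ if } p_1<\cdots<p_m \text{ in } P\}.$$ For a polytope $\mathcal{P}$ let $s_k(\mathcal{P})$ be the number of $k$-dimensional faces of $\mathcal{P}$ that are simplices, where $\mathcal{P}$ itself counts as a face. Let $\mathcal{F}$ be the smallest family of finite posets, closed under isomorphism, that contains all finite $\mathbf{X}$-free posets and is closed under disjoint union and under ordinal sum (the ordinal sum of $A$ and $B$ is $A\sqcup B$ with, in addition, every element of $A$ below every element of $B$). Then every $P\in\mathcal{F}$ satisfies $$s_k(\mathcal{O}(P))\le s_k(\mathcal{C}(P))\quad\text{for all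 integers } k\ge 0.$$ -/

import Mathlib

universe u

/-- The order polytope of `P`, inside `ℝ^P`. -/
def orderPolytope (P : Type u) [PartialOrder P] : Set (P → ℝ) :=
  {x | (∀ p, 0 ≤ x p ∧ x p ≤ 1) ∧ ∀ p q, p ≤ q → x p ≤ x q}

/-- The chain polytope of `P`, inside `ℝ^P`. -/
def chainPolytope (P : Type u) [PartialOrder P] : Set (P → ℝ) :=
  {x | (∀ p, 0 ≤ x p) ∧
    ∀ c : Finset P, IsChain (· ≤ ·) (c : Set P) → ∑ p ∈ c, x p ≤ 1}

/-- `F` is a `k`-dimensional simplex face of `K`: it is a face of `K` (the empty set, or the set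
of maximizers over `K` of a linear functional) and it is the convex hull of `k + 1` affinely
independent points. -/
def IsSimplexFace {ι : Type u} (K : Set (ι → ℝ)) (k : ℕ) (F : Set (ι → ℝ)) : Prop :=
  IsExposed ℝ K F ∧
    ∃ v : Fin (k + 1) → (ι → ℝ), AffineIndependent ℝ v ∧ F = convexHull ℝ (Set.range v)

/-- `s_k(K)`, the number of `k`-dimensional simplex faces of `K`. It is a cardinality in `ℕ∞`, so
that there is no default value for infinite sets. -/
noncomputable def simplexFaceCount {ι : Type u} (K : Set (ι → ℝ)) (k : ℕ) : ℕ∞ :=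
  {F : Set (ι → ℝ) | IsSimplexFace K k F}.encard

/-- The five-element poset `X`: two incomparable elements, below one element, below two
incomparable elements. (Here `⊕` carries the order of the disjoint union and `⊕ₗ` that of the
ordinal sum.) -/
abbrev PosetX : Type := ((Unit ⊕ Unit) ⊕ₗ Unit) ⊕ₗ (Unit ⊕ Unit)

/-- `P` is `X`-free: no induced subposet of `P` is isomorphic to `X`. -/
def XFree (P : Type u) [PartialOrder P] : Prop :=
  IsEmpty (PosetX ↪o P)

/-- The smallest family of finite posets, closed under isomorphism, that contains all finite
`X`-free posets and is closed under disjoint union and ordinal sum. -/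
inductive XFamily : (P : Type u) → [PartialOrder P] → Prop
  | of_xFree {P : Type u} [PartialOrder P] [Finite P] (h : XFree P) : XFamily P
  | disjointUnion {A B : Type u} [PartialOrder A] [PartialOrder B]
      (hA : XFamily A) (hB : XFamily B) : XFamily (A ⊕ B)
  | ordinalSum {A B : Type u} [PartialOrder A] [PartialOrder B]
      (hA : XFamily A) (hB : XFamily B) : XFamily (A ⊕ₗ B)
  | of_orderIso {A B : Type u} [PartialOrder A] [PartialOrder B]
      (e : A ≃o B) (hA : XFamily A) : XFamily B

/-!
For a finite set `V` of `0`-`1`-vectors, the simplex faces of the convex hull of `V` are determined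
by their vertex sets, so that `simplexFaceCount` is the number of affinely independent subsets of
`V` that are cut out by a supporting hyperplane (`simplexFaceCount_convexHull`). The order polytope
is the convex hull of the indicators of up-sets, the chain polytope that of the indicators of
antichains.

If `P` is `X`-free, then for each `c` the elements below `c` or the elements above `c` form a chain,
and an affine map built from these chains carries the antichains to the up-sets
(`XFree.bijOn_chainToOrder`); the face numbers agree. For a disjoint union both polytopes are
products, and a simplex face of a product is a simplex face of one factor times a vertex of the
other, so the inequality is inherited (`card_simplexFaces_sum_le`).

For an ordinal sum, both polytopes are obtained from those of the summands by gluing them at a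
vertex, in complementary coordinate subspaces. Let `α` and `α'` be the generating functions of the
simplex faces of a summand that avoid, respectively contain, the gluing vertex, where `α` counts a face by
its number of vertices and includes the empty face, while `α'` does not count the gluing vertex
itself. Then `S = α + t α'` counts all simplex faces, and for the glued polytope
`S = α β + t α' β'`. This grows when `α + t α'` grows and `α'` shrinks, because `β' ≤ β`: a simplex
face through a vertex is determined by the facet opposite to that vertex, which is a face as well
(`card_facesThrough_le_card_facesAvoiding`). It remains to see that the order polytope has at least
as many simplex faces through the gluing vertex as the chain polytope. Through the origin, the
simplex faces of the chain polytope correspond to the chains of the poset; and each chain gives a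
simplex face of the order polytope through `0`, with the principal up-sets of its elements as the
other vertices, and dually one through `1`.
-/

open Classical Finset

section SimplexVertexSets

/-! ### Vertex sets of simplex faces -/

variable {E F : Type*} [AddCommGroup E] [Module ℝ E] [AddCommGroup F] [Module ℝ F]

/-- `W` is the set of those points of the finite set `V` that lie on an exposed face of the convex
hull of `V`. The supporting hyperplane is the zero set of an affine function; with the constant
function `-1` the empty set counts as a face. -/
def IsFaceVertexSet (V W : Finset E) : Prop :=
  ∃ g : E →ᵃ[ℝ] ℝ, (∀ x ∈ V, g x ≤ 0) ∧ ∀ x, x ∈ W ↔ x ∈ V ∧ g x = 0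

/-- The vertex sets of simplex faces of the convex hull of `V`, provided that the points of `V` are
the vertices of their convex hull. -/
structure IsSimplexVertexSet (V W : Finset E) : Prop where
  face : IsFaceVertexSet V W
  indep : AffineIndependent ℝ ((↑) : W → E)

/-- The simplex faces of `V` with `n` vertices, including the empty one for `n = 0`. -/
noncomputable def simplexFaces (V : Finset E) (n : ℕ) : Finset (Finset E) :=
  {W ∈ V.powerset | IsSimplexVertexSet V W ∧ #W = n}

/-- The simplex faces with `n` vertices that avoid the point `u`. -/
noncomputable def facesAvoiding (V : Finset E) (u : E) (n : ℕ) : Finset (Finset E) :=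
  {W ∈ simplexFaces V n | u ∉ W}

/-- The simplex faces that contain `u` and have `n` vertices besides `u`. -/
noncomputable def facesThrough (V : Finset E) (u : E) (n : ℕ) : Finset (Finset E) :=
  {W ∈ simplexFaces V (n + 1) | u ∈ W}

theorem IsFaceVertexSet.subset {V W : Finset E} (h : IsFaceVertexSet V W) : W ⊆ V := by
  obtain ⟨g, -, hg⟩ := h
  exact fun x hx => ((hg x).1 hx).1

theorem mem_simplexFaces {V W : Finset E} {n : ℕ} :
    W ∈ simplexFaces V n ↔ IsSimplexVertexSet V W ∧ #W = n := by
  simp only [simplexFaces, mem_filter, mem_powerset, and_iff_right_iff_imp]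
  exact fun h => h.1.face.subset

theorem mem_facesAvoiding {V W : Finset E} {u : E} {n : ℕ} :
    W ∈ facesAvoiding V u n ↔ IsSimplexVertexSet V W ∧ #W = n ∧ u ∉ W := by
  simp [facesAvoiding, mem_simplexFaces, and_assoc]

theorem mem_facesThrough {V W : Finset E} {u : E} {n : ℕ} :
    W ∈ facesThrough V u n ↔ IsSimplexVertexSet V W ∧ #W = n + 1 ∧ u ∈ W := by
  simp [facesThrough, mem_simplexFaces, and_assoc]

theorem sum_dite_mem_subtype {α M : Type*} [AddCommMonoid M] {W : Finset α} (s : Finset W)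
    (f : W → M) : (∑ x ∈ W, if hx : x ∈ W then
      (if (⟨x, hx⟩ : W) ∈ s then f ⟨x, hx⟩ else 0) else 0) = ∑ x ∈ s, f x := by
  rw [← sum_attach]
  simp only [coe_mem, dite_true]
  rw [← sum_filter]
  congr 1
  ext; simp

theorem affineIndependent_coe_finset_iff (W : Finset E) :
    AffineIndependent ℝ ((↑) : W → E) ↔
      ∀ w : E → ℝ, ∑ x ∈ W, w x = 0 → ∑ x ∈ W, w x • x = 0 → ∀ x ∈ W, w x = 0 := by
  rw [affineIndependent_iff]
  constructor
  · intro h w h0 h1 x hx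
    have := h W.attach (fun x => w x) (by rwa [sum_attach W w])
      (by rwa [sum_attach W (fun x => w x • x)]) ⟨x, hx⟩ (mem_attach _ _)
    exact this
  · intro h s w h0 h1 e he
    have := h (fun x => if hx : x ∈ W then (if (⟨x, hx⟩ : W) ∈ s then w ⟨x, hx⟩ else 0) else 0)
      (by rw [sum_dite_mem_subtype]; exact h0)
      (by
        rw [← h1, ← sum_dite_mem_subtype s (fun e => w e • (e : E))]
        refine sum_congr rfl fun x hx => ?_
        simp only [hx, dite_true]
        split_ifs <;> simp) e e.2
    simpa [he] using this

/-- Affine independence is inherited along an affine map that embeds the points of `W` into an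
affinely independent set. -/
theorem affineIndependent_of_mapsTo {W : Finset E} {W' : Finset F}
    (hW' : AffineIndependent ℝ ((↑) : W' → F)) (f : E →ᵃ[ℝ] F) (hf : Set.InjOn f W)
    (hmem : ∀ x ∈ W, f x ∈ W') : AffineIndependent ℝ ((↑) : W → E) := by
  apply AffineIndependent.of_comp f
  exact hW'.comp_embedding ⟨fun x : W => ⟨f x, hmem x x.2⟩, fun x y hxy =>
    Subtype.ext (hf x.2 y.2 (congrArg Subtype.val hxy))⟩

theorem affineIndependent_of_subset {W W' : Finset E}
    (hW' : AffineIndependent ℝ ((↑) : W' → E)) (h : W ⊆ W') :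
    AffineIndependent ℝ ((↑) : W → E) :=
  affineIndependent_of_mapsTo hW' (AffineMap.id ℝ E) (fun _ _ _ _ h => h) (fun _ hx => h hx)

theorem isSimplexVertexSet_empty (V : Finset E) : IsSimplexVertexSet V ∅ := by
  refine ⟨⟨AffineMap.const ℝ E (-1), by simp, by simp⟩, ?_⟩
  rw [affineIndependent_coe_finset_iff]
  simp

theorem simplexFaces_zero (V : Finset E) : simplexFaces V 0 = {∅} := by
  ext W
  rw [mem_simplexFaces, mem_singleton, card_eq_zero]
  exact ⟨fun h => h.2, fun h => ⟨h ▸ isSimplexVertexSet_empty V, h⟩⟩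

theorem card_facesAvoiding_zero (V : Finset E) (u : E) : #(facesAvoiding V u 0) = 1 := by
  rw [facesAvoiding, simplexFaces_zero, filter_true_of_mem (by simp), card_singleton]

theorem card_simplexFaces_succ (V : Finset E) (u : E) (n : ℕ) :
    #(simplexFaces V (n + 1)) = #(facesAvoiding V u (n + 1)) + #(facesThrough V u n) := by
  rw [facesAvoiding, facesThrough, add_comm #_, card_filter_add_card_filter_not]

/-! ### Affine maps between vertex sets -/

/-- Faces pull back along an affine map that is a bijection of the vertex sets. -/
theorem IsSimplexVertexSet.pullback {V : Finset E} {V' W' : Finset F}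
    (h : IsSimplexVertexSet V' W') (f : E →ᵃ[ℝ] F) (hf : Set.BijOn f V V') :
    IsSimplexVertexSet V {x ∈ V | f x ∈ W'} ∧ #{x ∈ V | f x ∈ W'} = #W' := by
  have hsub := h.face.subset
  obtain ⟨⟨g, hg, hW⟩, hind⟩ := h
  refine ⟨⟨⟨g.comp f, fun x hx => hg _ (hf.mapsTo hx), fun x => ?_⟩,
    affineIndependent_of_mapsTo hind f (hf.injOn.mono (coe_subset.2 (filter_subset _ _)))
      (by simp)⟩, ?_⟩
  · rw [mem_filter, hW]
    have : x ∈ V → f x ∈ V' := fun hx => hf.mapsTo hx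
    simp only [AffineMap.comp_apply]
    tauto
  · refine card_nbij f (by simp [Set.MapsTo]) (hf.injOn.mono (coe_subset.2 (filter_subset _ _))) ?_
    intro y hy
    obtain ⟨x, hx, rfl⟩ := hf.surjOn (hsub hy)
    exact ⟨x, by simpa using ⟨hx, hy⟩, rfl⟩

theorem injOn_pullback {V : Finset E} {V' : Finset F} (f : E →ᵃ[ℝ] F) (hf : Set.BijOn f V V')
    (s : Set (Finset F)) (hs : ∀ W ∈ s, W ⊆ V') :
    Set.InjOn (fun W' => ({x ∈ V | f x ∈ W'} : Finset E)) s := by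
  intro W₁ h₁ W₂ h₂ h
  have key : ∀ W ∈ s, W = image f {x ∈ V | f x ∈ W} := by
    intro W hW
    ext y
    simp only [mem_image, mem_filter]
    refine ⟨fun hy => ?_, by rintro ⟨x, ⟨_, hx⟩, rfl⟩; exact hx⟩
    obtain ⟨x, hx, rfl⟩ := hf.surjOn (hs W hW hy)
    exact ⟨x, ⟨hx, hy⟩, rfl⟩
  rw [key W₁ h₁, key W₂ h₂]
  exact congrArg (image f) h

theorem card_simplexFaces_le_of_bijOn {V : Finset E} {V' : Finset F} (f : E →ᵃ[ℝ] F)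
    (hf : Set.BijOn f V V') (n : ℕ) : #(simplexFaces V' n) ≤ #(simplexFaces V n) := by
  refine card_le_card_of_injOn (fun W' => {x ∈ V | f x ∈ W'}) (fun W' hW' => ?_)
    (injOn_pullback f hf _ fun W hW => (mem_simplexFaces.1 hW).1.face.subset)
  rw [mem_coe, mem_simplexFaces] at *
  obtain ⟨h1, h2⟩ := hW'.1.pullback f hf
  exact ⟨h1, h2.trans hW'.2⟩

theorem card_facesThrough_le_of_bijOn {V : Finset E} {V' : Finset F} (f : E →ᵃ[ℝ] F)
    (hf : Set.BijOn f V V') {u : E} (hu : u ∈ V) (n : ℕ) :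
    #(facesThrough V' (f u) n) ≤ #(facesThrough V u n) := by
  refine card_le_card_of_injOn (fun W' => {x ∈ V | f x ∈ W'}) (fun W' hW' => ?_)
    (injOn_pullback f hf _ fun W hW => (mem_facesThrough.1 hW).1.face.subset)
  rw [mem_coe, mem_facesThrough] at *
  obtain ⟨h1, h2⟩ := hW'.1.pullback f hf
  exact ⟨h1, h2.trans hW'.2.1, by simpa using ⟨hu, hW'.2.2⟩⟩

/-! ### The facet opposite to a vertex -/

/-- A vertex of a simplex is separated from the others by an affine function vanishing on them. -/
theorem exists_affineMap_eq_neg_one {W : Finset E} (hW : AffineIndependent ℝ ((↑) : W → E))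
    {u : E} (hu : u ∈ W) :
    ∃ h : E →ᵃ[ℝ] ℝ, h u = -1 ∧ ∀ x ∈ W, x ≠ u → h x = 0 := by
  rcases (W.erase u).eq_empty_or_nonempty with he | ⟨w, hw⟩
  · refine ⟨AffineMap.const ℝ E (-1), by simp, fun x hx hxu => ?_⟩
    have : x ∈ W.erase u := mem_erase.2 ⟨hxu, hx⟩
    simp [he] at this
  · have hnot := hW.notMem_affineSpan_sdiff ⟨u, hu⟩ Set.univ
    set S := affineSpan ℝ (((↑) : W → E) '' (Set.univ \ {⟨u, hu⟩})) with hS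
    have hmem : ∀ x ∈ W, x ≠ u → x ∈ S := fun x hx hxu =>
      subset_affineSpan ℝ _ ⟨⟨x, hx⟩, ⟨trivial, by simpa using hxu⟩, rfl⟩
    have hwS := hmem w (mem_of_mem_erase hw) (ne_of_mem_erase hw)
    have hdir : u - w ∉ S.direction := by
      intro hd
      apply hnot
      have := AffineSubspace.vadd_mem_of_mem_direction hd hwS
      simpa using this
    obtain ⟨f, hf, hker⟩ := Submodule.exists_le_ker_of_notMem hdir
    refine ⟨(-(f (u - w))⁻¹ • f).toAffineMap + AffineMap.const ℝ E ((f (u - w))⁻¹ * f w), ?_, ?_⟩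
    · simp only [AffineMap.coe_add, Pi.add_apply, LinearMap.coe_toAffineMap, LinearMap.smul_apply,
        smul_eq_mul, AffineMap.const_apply]
      have : f (u - w) = f u - f w := map_sub _ _ _
      rw [this] at hf ⊢
      field_simp
      ring
    · intro x hx hxu
      have h0 : f (x - w) = 0 := hker (AffineSubspace.vsub_mem_direction (hmem x hx hxu) hwS)
      rw [map_sub, sub_eq_zero] at h0
      simp [h0]

/-- A facet of a simplex face is again a face: the supporting function is perturbed by a small
multiple of an affine function that vanishes on the facet and is negative at the vertex. -/
theorem IsSimplexVertexSet.erase {V W : Finset E} (h : IsSimplexVertexSet V W) {u : E}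
    (hu : u ∈ W) : IsSimplexVertexSet V (W.erase u) := by
  refine ⟨?_, affineIndependent_of_subset h.indep (erase_subset _ _)⟩
  obtain ⟨k, hku, hk⟩ := exists_affineMap_eq_neg_one h.indep hu
  obtain ⟨g, hg, hW⟩ := h.face
  have hev : ∀ᶠ ε : ℝ in nhdsWithin 0 (Set.Ioi 0), ∀ x ∈ V.filter (· ∉ W), g x + ε * k x < 0 := by
    rw [Filter.eventually_all_finset]
    intro x hx
    rw [mem_filter, hW] at hx
    have hlt : g x < 0 := lt_of_le_of_ne (hg x hx.1) fun h => hx.2 ⟨hx.1, h⟩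
    have hc : Continuous fun ε : ℝ => g x + ε * k x := by fun_prop
    have := hc.continuousAt (x := (0 : ℝ)) |>.eventually_lt_const (u := 0) (by simpa using hlt)
    exact this.filter_mono nhdsWithin_le_nhds
  obtain ⟨ε, hε, hpos⟩ := (hev.and self_mem_nhdsWithin).exists
  have hpos : 0 < ε := hpos
  have hval : ∀ x, (g + ε • k) x = g x + ε * k x := fun x => rfl
  have hlt : ∀ x ∈ V, x ∉ W.erase u → (g + ε • k) x < 0 := by
    intro x hx hxe
    rw [hval]
    by_cases hxW : x ∈ W
    · have hxu : x = u := by by_contra hne; exact hxe (mem_erase.2 ⟨hne, hxW⟩)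
      rw [hxu, hku, ((hW u).1 hu).2]
      linarith
    · exact hε x (mem_filter.2 ⟨hx, hxW⟩)
  have hzero : ∀ x ∈ W.erase u, (g + ε • k) x = 0 := by
    intro x hx
    rw [mem_erase] at hx
    rw [hval, hk x hx.2 hx.1, ((hW x).1 hx.2).2]
    simp
  refine ⟨g + ε • k, fun x hx => ?_, fun x => ⟨fun hx => ⟨?_, hzero x hx⟩, fun hx => ?_⟩⟩
  · by_cases hxe : x ∈ W.erase u
    · exact (hzero x hxe).le
    · exact (hlt x hx hxe).le
  · exact h.face.subset (mem_of_mem_erase hx)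
  · by_contra hxe
    exact (hlt x hx.1 hxe).ne hx.2

theorem card_facesThrough_le_card_facesAvoiding (V : Finset E) (u : E) (n : ℕ) :
    #(facesThrough V u n) ≤ #(facesAvoiding V u n) := by
  refine card_le_card_of_injOn (fun W => W.erase u) (fun W hW => ?_) ?_
  · rw [mem_coe, mem_facesThrough] at hW
    rw [mem_coe, mem_facesAvoiding]
    refine ⟨hW.1.erase hW.2.2, ?_, by simp⟩
    rw [card_erase_of_mem hW.2.2, hW.2.1]
    rfl
  · intro W₁ h₁ W₂ h₂ h
    rw [mem_coe, mem_facesThrough] at h₁ h₂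
    rw [← insert_erase h₁.2.2, ← insert_erase h₂.2.2]
    exact congrArg (insert u) h

end SimplexVertexSets

section Wedge

/-! ### Two point sets glued at a point -/

variable {E F : Type*}

/-- The union of a copy of `VA` and a copy of `VB` in the product space, which meet in the
point `(u, v)` if `u ∈ VA` and `v ∈ VB`. -/
noncomputable def wedge (u : E) (v : F) (VA : Finset E) (VB : Finset F) : Finset (E × F) :=
  VA ×ˢ {v} ∪ {u} ×ˢ VB

/-- The points of `VA` whose copy lies in `W`. -/
noncomputable def wedgeLeft (v : F) (VA : Finset E) (W : Finset (E × F)) : Finset E :=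
  {x ∈ VA | (x, v) ∈ W}

/-- The points of `VB` whose copy lies in `W`. -/
noncomputable def wedgeRight (u : E) (VB : Finset F) (W : Finset (E × F)) : Finset F :=
  {y ∈ VB | (u, y) ∈ W}

variable {u : E} {v : F} {VA WA : Finset E} {VB WB : Finset F} {W : Finset (E × F)}

theorem mem_wedge {p : E × F} :
    p ∈ wedge u v VA VB ↔ p.1 ∈ VA ∧ p.2 = v ∨ p.1 = u ∧ p.2 ∈ VB := by
  simp only [wedge, mem_union, mem_product, mem_singleton]

theorem left_mem_wedge {x : E} (hx : x ∈ VA) : (x, v) ∈ wedge u v VA VB := by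
  simp [mem_wedge, hx]

theorem right_mem_wedge {y : F} (hy : y ∈ VB) : (u, y) ∈ wedge u v VA VB := by
  simp [mem_wedge, hy]

theorem base_mem_wedge_iff (h : u ∈ WA ↔ v ∈ WB) : (u, v) ∈ wedge u v WA WB ↔ u ∈ WA := by
  simp [mem_wedge, h]

theorem wedgeLeft_wedge (hA : WA ⊆ VA) (h : u ∈ WA ↔ v ∈ WB) :
    wedgeLeft v VA (wedge u v WA WB) = WA := by
  ext x
  simp only [wedgeLeft, mem_filter, mem_wedge]
  constructor
  · rintro ⟨-, hx | ⟨rfl, hv⟩⟩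
    exacts [hx.1, h.2 hv]
  · exact fun hx => ⟨hA hx, Or.inl ⟨hx, trivial⟩⟩

theorem wedgeRight_wedge (hB : WB ⊆ VB) (h : u ∈ WA ↔ v ∈ WB) :
    wedgeRight u VB (wedge u v WA WB) = WB := by
  ext x
  simp only [wedgeRight, mem_filter, mem_wedge]
  constructor
  · rintro ⟨-, ⟨hu, rfl⟩ | hx⟩
    exacts [h.1 hu, hx.2]
  · exact fun hx => ⟨hB hx, Or.inr ⟨trivial, hx⟩⟩

theorem wedge_left_right (hW : W ⊆ wedge u v VA VB) :
    wedge u v (wedgeLeft v VA W) (wedgeRight u VB W) = W := by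
  ext ⟨x, y⟩
  simp only [mem_wedge, wedgeLeft, wedgeRight, mem_filter]
  constructor
  · rintro (⟨⟨-, h⟩, rfl⟩ | ⟨rfl, -, h⟩) <;> exact h
  · intro h
    rcases mem_wedge.1 (hW h) with ⟨hx, hy⟩ | ⟨hx, hy⟩
    · simp only at hx hy
      subst hy
      exact Or.inl ⟨⟨hx, h⟩, rfl⟩
    · simp only at hx hy
      subst hx
      exact Or.inr ⟨rfl, hy, h⟩

theorem mem_wedgeLeft_iff_mem_wedgeRight (hu : u ∈ VA) (hv : v ∈ VB) :
    u ∈ wedgeLeft v VA W ↔ v ∈ wedgeRight u VB W := by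
  simp [wedgeLeft, wedgeRight, hu, hv]

theorem mem_wedgeLeft_iff (hu : u ∈ VA) : u ∈ wedgeLeft v VA W ↔ (u, v) ∈ W := by
  simp [wedgeLeft, hu]

theorem disjoint_wedge_parts (h : v ∉ WB) :
    Disjoint (WA ×ˢ ({v} : Finset F)) (({u} : Finset E) ×ˢ WB) := by
  rw [Finset.disjoint_left]
  rintro ⟨x, y⟩ h1 h2
  simp only [mem_product, mem_singleton] at h1 h2
  exact h (h1.2 ▸ h2.2)

theorem wedge_erase (hu : u ∈ WA) : wedge u v WA (WB.erase v) = wedge u v WA WB := by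
  ext ⟨x, y⟩
  simp only [mem_wedge, mem_erase]
  by_cases hy : y = v
  · subst hy
    constructor
    · tauto
    · rintro (h | ⟨rfl, -⟩)
      · exact Or.inl h
      · exact Or.inl ⟨hu, rfl⟩
  · tauto

theorem card_wedge_of_notMem (h : v ∉ WB) : #(wedge u v WA WB) = #WA + #WB := by
  rw [wedge, card_union_of_disjoint (disjoint_wedge_parts h)]
  simp

theorem card_wedge_of_mem (hu : u ∈ WA) (hv : v ∈ WB) :
    #(wedge u v WA WB) + 1 = #WA + #WB := by
  rw [← wedge_erase hu, card_wedge_of_notMem (by simp), add_assoc, card_erase_add_one hv]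

end Wedge

section SumsOfVertexSets

variable {E F : Type*} [AddCommGroup E] [Module ℝ E] [AddCommGroup F] [Module ℝ F]

/-! ### Faces of two polytopes glued at a vertex -/

theorem sum_mul_affineMap_eq_zero (g : E →ᵃ[ℝ] ℝ) (W : Finset E) (w : E → ℝ)
    (h0 : ∑ x ∈ W, w x = 0) (h1 : ∑ x ∈ W, w x • x = 0) : ∑ x ∈ W, w x * g x = 0 := by
  have hg : ∀ x, w x * g x = g.linear (w x • x) + w x * g 0 := fun x => by
    rw [map_smul, smul_eq_mul, ← mul_add]
    exact congrArg _ (congrFun g.decomp x)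
  rw [sum_congr rfl fun x _ => hg x, sum_add_distrib, ← map_sum, h1, ← sum_mul, h0]
  simp

/-- A point outside of a simplex face can be added to its vertices, keeping affine
independence. -/
theorem IsSimplexVertexSet.insert_indep {V W : Finset E} (h : IsSimplexVertexSet V W) {v : E}
    (hv : v ∈ V) (hvW : v ∉ W) :
    AffineIndependent ℝ ((↑) : ↥(insert v W) → E) := by
  obtain ⟨g, -, hW⟩ := h.face
  have hind := (affineIndependent_coe_finset_iff W).1 h.indep
  rw [affineIndependent_coe_finset_iff]
  intro w h0 h1
  have hg := sum_mul_affineMap_eq_zero g _ w h0 h1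
  rw [sum_insert hvW] at h0 h1 hg
  rw [sum_eq_zero (fun x hx => by rw [((hW x).1 hx).2, mul_zero]), add_zero] at hg
  have hgv : g v ≠ 0 := fun h => hvW ((hW v).2 ⟨hv, h⟩)
  have hwv : w v = 0 := (mul_eq_zero.1 hg).resolve_right hgv
  rw [hwv] at h0 h1
  intro x hx
  rcases mem_insert.1 hx with rfl | hx
  · exact hwv
  · exact hind w (by simpa using h0) (by simpa using h1) x hx

/-- The supporting function of a face can be scaled to take the value `-1` at a given point off the face. -/
theorem IsFaceVertexSet.exists_eq_neg_one {V W : Finset E} (h : IsFaceVertexSet V W) {u : E}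
    (hu : u ∈ V) (huW : u ∉ W) :
    ∃ g : E →ᵃ[ℝ] ℝ, (∀ x ∈ V, g x ≤ 0) ∧ (∀ x, x ∈ W ↔ x ∈ V ∧ g x = 0) ∧ g u = -1 := by
  obtain ⟨g, hg, hW⟩ := h
  have hgu : g u < 0 := lt_of_le_of_ne (hg u hu) fun h => huW ((hW u).2 ⟨hu, h⟩)
  have hpos : 0 < (-g u)⁻¹ := inv_pos.2 (by linarith)
  have hval : ∀ x, ((-g u)⁻¹ • g) x = (-g u)⁻¹ * g x := fun x => rfl
  refine ⟨(-g u)⁻¹ • g, fun x hx => ?_, fun x => ?_, ?_⟩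
  · rw [hval]
    exact mul_nonpos_of_nonneg_of_nonpos hpos.le (hg x hx)
  · rw [hW, hval]
    simp [hgu.ne]
  · rw [hval, inv_neg, neg_mul, inv_mul_cancel₀ hgu.ne]

variable {u : E} {v : F} {VA WA : Finset E} {VB WB : Finset F} {W : Finset (E × F)}

/-- Appending `v` to `WB` accounts for the second coordinate of all points of the copy of `WA`. -/
theorem affineIndependent_wedge (hA : AffineIndependent ℝ ((↑) : WA → E)) (hv : v ∉ WB)
    (hB : AffineIndependent ℝ ((↑) : ↥(insert v WB) → F)) :
    AffineIndependent ℝ ((↑) : wedge u v WA WB → E × F) := by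
  rw [affineIndependent_coe_finset_iff] at *
  intro w h0 h1
  rw [wedge, sum_union (disjoint_wedge_parts hv)] at h0 h1
  simp only [sum_product, sum_singleton] at h0 h1
  have hfst := congrArg Prod.fst h1
  have hsnd := congrArg Prod.snd h1
  simp only [Prod.fst_add, Prod.snd_add, Prod.fst_sum, Prod.snd_sum, Prod.smul_fst, Prod.smul_snd,
    Prod.fst_zero, Prod.snd_zero, ← sum_smul] at hfst hsnd
  -- The second coordinate is an affine dependence among `v` and the points of `WB`.
  have hne : ∀ y ∈ WB, y ≠ v := fun y hy h => hv (h ▸ hy)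
  have key := hB (fun y => if y = v then ∑ x ∈ WA, w (x, v) else w (u, y))
    (by
      rw [sum_insert hv, if_pos rfl, sum_congr rfl fun y hy => if_neg (hne y hy)]
      exact h0)
    (by
      have hite : ∑ y ∈ WB, (if y = v then ∑ x ∈ WA, w (x, v) else w (u, y)) • y =
          ∑ y ∈ WB, w (u, y) • y := sum_congr rfl fun y hy => by rw [if_neg (hne y hy)]
      rw [sum_insert hv, if_pos rfl, hite]
      exact hsnd)
  have hΛ : ∑ x ∈ WA, w (x, v) = 0 := by simpa using key v (mem_insert_self _ _)
  have hμ : ∀ y ∈ WB, w (u, y) = 0 := fun y hy => by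
    simpa [hne y hy] using key y (mem_insert_of_mem hy)
  rw [sum_eq_zero hμ, zero_smul, add_zero] at hfst
  have hlam := hA (fun x => w (x, v)) hΛ hfst
  rintro ⟨x, y⟩ hp
  rcases mem_wedge.1 hp with ⟨hx, rfl⟩ | ⟨rfl, hy⟩
  exacts [hlam x hx, hμ y hy]

/-- Simplex faces of the two summands that both avoid, or both contain, the common vertex combine
to a simplex face. -/
theorem IsSimplexVertexSet.wedge (hA : IsSimplexVertexSet VA WA) (hB : IsSimplexVertexSet VB WB)
    (hu : u ∈ VA) (hv : v ∈ VB) (h : u ∈ WA ↔ v ∈ WB) :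
    IsSimplexVertexSet (wedge u v VA VB) (wedge u v WA WB) := by
  constructor
  · -- After rescaling, the two supporting functions agree at the common vertex.
    obtain ⟨gA, gB, hgA, hWA, hgB, hWB, huv⟩ : ∃ (gA : E →ᵃ[ℝ] ℝ) (gB : F →ᵃ[ℝ] ℝ),
        (∀ x ∈ VA, gA x ≤ 0) ∧ (∀ x, x ∈ WA ↔ x ∈ VA ∧ gA x = 0) ∧
        (∀ x ∈ VB, gB x ≤ 0) ∧ (∀ x, x ∈ WB ↔ x ∈ VB ∧ gB x = 0) ∧ gA u = gB v := by
      by_cases huW : u ∈ WA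
      · obtain ⟨gA, hgA, hWA⟩ := hA.face
        obtain ⟨gB, hgB, hWB⟩ := hB.face
        exact ⟨gA, gB, hgA, hWA, hgB, hWB,
          ((hWA u).1 huW).2.trans ((hWB v).1 (h.1 huW)).2.symm⟩
      · obtain ⟨gA, hgA, hWA, hgu⟩ := hA.face.exists_eq_neg_one hu huW
        obtain ⟨gB, hgB, hWB, hgv⟩ := hB.face.exists_eq_neg_one hv (h.not.1 huW)
        exact ⟨gA, gB, hgA, hWA, hgB, hWB, hgu.trans hgv.symm⟩
    let g : E × F →ᵃ[ℝ] ℝ := gA.comp AffineMap.fst + gB.comp AffineMap.snd -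
      AffineMap.const ℝ (E × F) (gB v)
    have hl : ∀ x, g (x, v) = gA x := fun x => by
      change gA x + gB v - gB v = gA x
      ring
    have hr : ∀ y, g (u, y) = gB y := fun y => by
      change gA u + gB y - gB v = gB y
      rw [huv]; ring
    refine ⟨g, ?_, ?_⟩
    · rintro ⟨x, y⟩ hp
      rcases mem_wedge.1 hp with ⟨hx, rfl⟩ | ⟨rfl, hy⟩
      · rw [hl]; exact hgA x hx
      · rw [hr]; exact hgB y hy
    · rintro ⟨x, y⟩
      constructor
      · intro hp
        rcases mem_wedge.1 hp with ⟨hx, rfl⟩ | ⟨rfl, hy⟩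
        · rw [hl]
          exact ⟨left_mem_wedge ((hWA x).1 hx).1, ((hWA x).1 hx).2⟩
        · rw [hr]
          exact ⟨right_mem_wedge ((hWB y).1 hy).1, ((hWB y).1 hy).2⟩
      · rintro ⟨hp, hg⟩
        rcases mem_wedge.1 hp with ⟨hx, rfl⟩ | ⟨rfl, hy⟩
        · rw [hl] at hg
          exact left_mem_wedge ((hWA x).2 ⟨hx, hg⟩)
        · rw [hr] at hg
          exact right_mem_wedge ((hWB y).2 ⟨hy, hg⟩)
  · by_cases hvW : v ∈ WB
    · rw [← wedge_erase (h.2 hvW)]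
      refine affineIndependent_wedge hA.indep (by simp) ?_
      rw [insert_erase hvW]
      exact hB.indep
    · exact affineIndependent_wedge hA.indep hvW (hB.insert_indep hv hvW)

theorem IsSimplexVertexSet.wedgeLeft (h : IsSimplexVertexSet (_root_.wedge u v VA VB) W) :
    IsSimplexVertexSet VA (_root_.wedgeLeft v VA W) := by
  obtain ⟨⟨g, hg, hW⟩, hind⟩ := h
  let f : E →ᵃ[ℝ] E × F := (AffineMap.id ℝ E).prod (AffineMap.const ℝ E v)
  have hf : ∀ x, f x = (x, v) := fun x => rfl
  refine ⟨⟨g.comp f, fun x hx => hg _ (left_mem_wedge hx), fun x => ?_⟩,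
    affineIndependent_of_mapsTo hind f (fun x _ y _ hxy => (Prod.mk.inj hxy).1)
      (fun x hx => (mem_filter.1 hx).2)⟩
  rw [_root_.wedgeLeft, mem_filter, hW, AffineMap.comp_apply, hf]
  exact ⟨fun hx => ⟨hx.1, hx.2.2⟩, fun hx => ⟨hx.1, left_mem_wedge hx.1, hx.2⟩⟩

theorem IsSimplexVertexSet.wedgeRight (h : IsSimplexVertexSet (_root_.wedge u v VA VB) W) :
    IsSimplexVertexSet VB (_root_.wedgeRight u VB W) := by
  obtain ⟨⟨g, hg, hW⟩, hind⟩ := h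
  let f : F →ᵃ[ℝ] E × F := (AffineMap.const ℝ F u).prod (AffineMap.id ℝ F)
  have hf : ∀ x, f x = (u, x) := fun x => rfl
  refine ⟨⟨g.comp f, fun x hx => hg _ (right_mem_wedge hx), fun x => ?_⟩,
    affineIndependent_of_mapsTo hind f (fun x _ y _ hxy => (Prod.mk.inj hxy).2)
      (fun x hx => (mem_filter.1 hx).2)⟩
  rw [_root_.wedgeRight, mem_filter, hW, AffineMap.comp_apply, hf]
  exact ⟨fun hx => ⟨hx.1, hx.2.2⟩, fun hx => ⟨hx.1, right_mem_wedge hx.1, hx.2⟩⟩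

theorem card_facesAvoiding_wedge (hu : u ∈ VA) (hv : v ∈ VB) (n : ℕ) :
    #(facesAvoiding (wedge u v VA VB) (u, v) n) =
      ∑ p ∈ antidiagonal n, #(facesAvoiding VA u p.1) * #(facesAvoiding VB v p.2) := by
  simp_rw [← card_product]
  rw [← card_sigma]
  symm
  refine card_nbij (fun s => wedge u v s.2.1 s.2.2) ?_ ?_ ?_
  · rintro ⟨⟨i, j⟩, WA, WB⟩ hs
    simp only [coe_sigma, Set.mem_sigma_iff, mem_coe, HasAntidiagonal.mem_antidiagonal, mem_product,
      mem_facesAvoiding] at hs ⊢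
    obtain ⟨hn, ⟨hA, hi, huA⟩, hB, hj, hvB⟩ := hs
    have huv : u ∈ WA ↔ v ∈ WB := by simp [huA, hvB]
    exact ⟨hA.wedge hB hu hv huv, by rw [card_wedge_of_notMem hvB]; omega,
      (base_mem_wedge_iff huv).not.2 huA⟩
  · rintro ⟨⟨i, j⟩, WA, WB⟩ hs ⟨⟨i', j'⟩, WA', WB'⟩ hs' heq
    simp only [coe_sigma, Set.mem_sigma_iff, mem_coe, HasAntidiagonal.mem_antidiagonal, mem_product,
      mem_facesAvoiding] at hs hs' heq
    obtain ⟨-, ⟨hA, hi, huA⟩, hB, hj, hvB⟩ := hs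
    obtain ⟨-, ⟨hA', hi', huA'⟩, hB', hj', hvB'⟩ := hs'
    have huv : u ∈ WA ↔ v ∈ WB := by simp [huA, hvB]
    have huv' : u ∈ WA' ↔ v ∈ WB' := by simp [huA', hvB']
    have e1 : WA = WA' := by
      rw [← wedgeLeft_wedge hA.face.subset huv, heq, wedgeLeft_wedge hA'.face.subset huv']
    have e2 : WB = WB' := by
      rw [← wedgeRight_wedge hB.face.subset huv, heq, wedgeRight_wedge hB'.face.subset huv']
    subst e1 e2 hi hj hi' hj'
    rfl
  · intro W hW
    rw [mem_coe, mem_facesAvoiding] at hW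
    obtain ⟨hW, hn, huv⟩ := hW
    have e := wedge_left_right hW.face.subset
    have hiff := mem_wedgeLeft_iff_mem_wedgeRight (W := W) hu hv
    have hnl : u ∉ wedgeLeft v VA W := (mem_wedgeLeft_iff hu).not.2 huv
    have hnr := hiff.not.1 hnl
    refine ⟨⟨(#(wedgeLeft v VA W), #(wedgeRight u VB W)), wedgeLeft v VA W, wedgeRight u VB W⟩,
      ?_, e⟩
    simp only [coe_sigma, Set.mem_sigma_iff, mem_coe, HasAntidiagonal.mem_antidiagonal, mem_product,
      mem_facesAvoiding]
    refine ⟨?_, ⟨hW.wedgeLeft, trivial, hnl⟩, hW.wedgeRight, trivial, hnr⟩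
    rw [← card_wedge_of_notMem hnr (u := u), e, hn]

theorem card_facesThrough_wedge (hu : u ∈ VA) (hv : v ∈ VB) (n : ℕ) :
    #(facesThrough (wedge u v VA VB) (u, v) n) =
      ∑ p ∈ antidiagonal n, #(facesThrough VA u p.1) * #(facesThrough VB v p.2) := by
  simp_rw [← card_product]
  rw [← card_sigma]
  symm
  refine card_nbij (fun s => wedge u v s.2.1 s.2.2) ?_ ?_ ?_
  · rintro ⟨⟨i, j⟩, WA, WB⟩ hs
    simp only [coe_sigma, Set.mem_sigma_iff, mem_coe, HasAntidiagonal.mem_antidiagonal, mem_product,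
      mem_facesThrough] at hs ⊢
    obtain ⟨hn, ⟨hA, hi, huA⟩, hB, hj, hvB⟩ := hs
    have huv : u ∈ WA ↔ v ∈ WB := by simp [huA, hvB]
    have hc := card_wedge_of_mem huA hvB
    exact ⟨hA.wedge hB hu hv huv, by omega, (base_mem_wedge_iff huv).2 huA⟩
  · rintro ⟨⟨i, j⟩, WA, WB⟩ hs ⟨⟨i', j'⟩, WA', WB'⟩ hs' heq
    simp only [coe_sigma, Set.mem_sigma_iff, mem_coe, HasAntidiagonal.mem_antidiagonal, mem_product,
      mem_facesThrough] at hs hs' heq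
    obtain ⟨-, ⟨hA, hi, huA⟩, hB, hj, hvB⟩ := hs
    obtain ⟨-, ⟨hA', hi', huA'⟩, hB', hj', hvB'⟩ := hs'
    have huv : u ∈ WA ↔ v ∈ WB := by simp [huA, hvB]
    have huv' : u ∈ WA' ↔ v ∈ WB' := by simp [huA', hvB']
    have e1 : WA = WA' := by
      rw [← wedgeLeft_wedge hA.face.subset huv, heq, wedgeLeft_wedge hA'.face.subset huv']
    have e2 : WB = WB' := by
      rw [← wedgeRight_wedge hB.face.subset huv, heq, wedgeRight_wedge hB'.face.subset huv']
    subst e1 e2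
    obtain rfl : i = i' := by omega
    obtain rfl : j = j' := by omega
    rfl
  · intro W hW
    rw [mem_coe, mem_facesThrough] at hW
    obtain ⟨hW, hn, huv⟩ := hW
    have e := wedge_left_right hW.face.subset
    have hiff := mem_wedgeLeft_iff_mem_wedgeRight (W := W) hu hv
    have hnl : u ∈ wedgeLeft v VA W := (mem_wedgeLeft_iff hu).2 huv
    have hnr := hiff.1 hnl
    have hl := card_pos.2 ⟨u, hnl⟩
    have hr := card_pos.2 ⟨v, hnr⟩
    refine ⟨⟨(#(wedgeLeft v VA W) - 1, #(wedgeRight u VB W) - 1), wedgeLeft v VA W,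
      wedgeRight u VB W⟩, ?_, e⟩
    simp only [coe_sigma, Set.mem_sigma_iff, mem_coe, HasAntidiagonal.mem_antidiagonal, mem_product,
      mem_facesThrough]
    refine ⟨?_, ⟨hW.wedgeLeft, by omega, hnl⟩, hW.wedgeRight, by omega, hnr⟩
    have hc := card_wedge_of_mem hnl hnr
    rw [e] at hc
    omega

/-! ### Products -/

theorem card_le_one_or_of_affineIndependent_product
    (h : AffineIndependent ℝ ((↑) : ↥(WA ×ˢ WB) → E × F)) :
    #WA ≤ 1 ∨ #WB ≤ 1 := by
  by_contra! hc
  obtain ⟨x, hx, x', hx', hxx⟩ := one_lt_card.1 hc.1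
  obtain ⟨y, hy, y', hy', hyy⟩ := one_lt_card.1 hc.2
  -- Four vertices of a parallelogram are affinely dependent.
  have hsub : ({(x, y), (x', y'), (x, y'), (x', y)} : Finset (E × F)) ⊆ WA ×ˢ WB := by
    intro p hp
    simp only [mem_insert, mem_singleton] at hp
    rcases hp with rfl | rfl | rfl | rfl <;> simp [*]
  have h4 := (affineIndependent_coe_finset_iff _).1 (affineIndependent_of_subset h hsub)
    (fun p => if p = (x, y) ∨ p = (x', y') then 1 else -1)
    (by
      rw [sum_insert, sum_insert, sum_insert, sum_singleton] <;>
        simp [hxx, hyy, hxx.symm, hyy.symm])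
    (by
      rw [sum_insert, sum_insert, sum_insert, sum_singleton] <;>
        simp [hxx, hyy, hxx.symm, hyy.symm])
    (x, y) (by simp)
  simp at h4

/-- A supporting function of a product splits as a sum, so the face it cuts out contains `(x, y')`
with any two points `(x, y)` and `(x', y')`. -/
theorem IsFaceVertexSet.eq_product (h : IsFaceVertexSet (VA ×ˢ VB) W) :
    W = W.image Prod.fst ×ˢ W.image Prod.snd := by
  refine Subset.antisymm (fun p hp => mem_product.2
    ⟨mem_image_of_mem _ hp, mem_image_of_mem _ hp⟩) ?_
  rintro ⟨x, y'⟩ hp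
  obtain ⟨hx, hy⟩ := mem_product.1 hp
  obtain ⟨⟨x, y⟩, hxy, rfl⟩ := mem_image.1 hx
  obtain ⟨⟨x', y'⟩, hxy', rfl⟩ := mem_image.1 hy
  obtain ⟨g, hg, hW⟩ := h
  have h1 := (hW _).1 hxy
  have h2 := (hW _).1 hxy'
  have m1 := mem_product.1 h1.1
  have m2 := mem_product.1 h2.1
  have hg1 := hg (x, y') (mem_product.2 ⟨m1.1, m2.2⟩)
  have hg2 := hg (x', y) (mem_product.2 ⟨m2.1, m1.2⟩)
  have hadd : g (x, y) + g (x', y') = g (x, y') + g (x', y) := by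
    have hd : ∀ p, g p = g.linear p + g 0 := fun p => congrFun g.decomp p
    have : g.linear (x, y) + g.linear (x', y') = g.linear (x, y') + g.linear (x', y) := by
      rw [← map_add, ← map_add]
      simp [add_comm]
    rw [hd (x, y), hd (x', y'), hd (x, y'), hd (x', y)]
    linarith
  rw [h1.2, h2.2] at hadd
  exact (hW _).2 ⟨mem_product.2 ⟨m1.1, m2.2⟩, by simp only at *; linarith⟩

theorem IsFaceVertexSet.product (hA : IsFaceVertexSet VA WA) (hB : IsFaceVertexSet VB WB) :
    IsFaceVertexSet (VA ×ˢ VB) (WA ×ˢ WB) := by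
  obtain ⟨gA, hgA, hWA⟩ := hA
  obtain ⟨gB, hgB, hWB⟩ := hB
  refine ⟨gA.comp AffineMap.fst + gB.comp AffineMap.snd, ?_, ?_⟩
  · rintro ⟨x, y⟩ hp
    rw [mem_product] at hp
    exact add_nonpos (hgA x hp.1) (hgB y hp.2)
  · rintro ⟨x, y⟩
    change _ ↔ _ ∧ gA x + gB y = 0
    rw [ mem_product, mem_product, hWA, hWB]
    constructor
    · rintro ⟨⟨h1, h2⟩, h3, h4⟩
      simp only at *
      exact ⟨⟨h1, h3⟩, by rw [h2, h4, add_zero]⟩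
    · rintro ⟨⟨h1, h2⟩, h3⟩
      have := hgA x h1
      have := hgB y h2
      simp only at *
      exact ⟨⟨h1, by linarith⟩, h2, by linarith⟩

theorem affineIndependent_product (hA : AffineIndependent ℝ ((↑) : WA → E))
    (hB : AffineIndependent ℝ ((↑) : WB → F)) (h : #WA = 1 ∨ #WB = 1) :
    AffineIndependent ℝ ((↑) : ↥(WA ×ˢ WB) → E × F) := by
  rcases h with h | h
  · obtain ⟨x, rfl⟩ := card_eq_one.1 h
    refine affineIndependent_of_mapsTo hB AffineMap.snd ?_ ?_
    · rintro ⟨x₁, y₁⟩ h1 ⟨x₂, y₂⟩ h2 heq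
      simp only [coe_product, coe_singleton, Set.mem_prod, Set.mem_singleton_iff] at h1 h2
      exact Prod.ext (h1.1.trans h2.1.symm) heq
    · rintro ⟨x₁, y₁⟩ h1
      exact (mem_product.1 h1).2
  · obtain ⟨y, rfl⟩ := card_eq_one.1 h
    refine affineIndependent_of_mapsTo hA AffineMap.fst ?_ ?_
    · rintro ⟨x₁, y₁⟩ h1 ⟨x₂, y₂⟩ h2 heq
      simp only [coe_product, coe_singleton, Set.mem_prod, Set.mem_singleton_iff] at h1 h2
      exact Prod.ext heq (h1.2.trans h2.2.symm)
    · rintro ⟨x₁, y₁⟩ h1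
      exact (mem_product.1 h1).1

theorem IsSimplexVertexSet.fst_of_product (h : IsSimplexVertexSet (VA ×ˢ VB) (WA ×ˢ WB)) {y : F}
    (hy : y ∈ WB) (hyV : y ∈ VB) : IsSimplexVertexSet VA WA := by
  obtain ⟨⟨g, hg, hW⟩, hind⟩ := h
  let f : E →ᵃ[ℝ] E × F := (AffineMap.id ℝ E).prod (AffineMap.const ℝ E y)
  refine ⟨⟨g.comp f, fun x hx => hg _ (mem_product.2 ⟨hx, hyV⟩), fun x => ?_⟩,
    affineIndependent_of_mapsTo hind f (fun x _ y _ hxy => (Prod.mk.inj hxy).1)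
      (fun x hx => mem_product.2 ⟨hx, hy⟩)⟩
  have := hW (x, y)
  rw [mem_product, mem_product] at this
  change _ ↔ _ ∧ g (x, y) = 0
  simp only at this
  tauto

theorem IsSimplexVertexSet.snd_of_product (h : IsSimplexVertexSet (VA ×ˢ VB) (WA ×ˢ WB)) {x : E}
    (hx : x ∈ WA) (hxV : x ∈ VA) : IsSimplexVertexSet VB WB := by
  obtain ⟨⟨g, hg, hW⟩, hind⟩ := h
  let f : F →ᵃ[ℝ] E × F := (AffineMap.const ℝ F x).prod (AffineMap.id ℝ F)
  refine ⟨⟨g.comp f, fun y hy => hg _ (mem_product.2 ⟨hxV, hy⟩), fun y => ?_⟩,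
    affineIndependent_of_mapsTo hind f (fun x _ y _ hxy => (Prod.mk.inj hxy).2)
      (fun y hy => mem_product.2 ⟨hx, hy⟩)⟩
  have := hW (x, y)
  rw [mem_product, mem_product] at this
  change _ ↔ _ ∧ g (x, y) = 0
  simp only at this
  tauto

/-- A nonempty simplex face of a product is the product of a simplex face with a vertex. The two
index pairs coincide for `n = 0`, which is why the sum is over a set. -/
theorem card_simplexFaces_product (VA : Finset E) (VB : Finset F) (n : ℕ) :
    #(simplexFaces (VA ×ˢ VB) (n + 1)) =
      ∑ p ∈ ({(n + 1, 1), (1, n + 1)} : Finset (ℕ × ℕ)),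
        #(simplexFaces VA p.1) * #(simplexFaces VB p.2) := by
  simp_rw [← card_product]
  rw [← card_sigma]
  symm
  refine card_nbij (fun s => s.2.1 ×ˢ s.2.2) ?_ ?_ ?_
  · rintro ⟨⟨i, j⟩, WA, WB⟩ hs
    simp only [coe_sigma, Set.mem_sigma_iff, mem_coe, mem_insert, mem_singleton, mem_product,
      mem_simplexFaces, Prod.mk.injEq] at hs ⊢
    obtain ⟨hn, ⟨hA, hi⟩, hB, hj⟩ := hs
    refine ⟨⟨hA.face.product hB.face, affineIndependent_product hA.indep hB.indep ?_⟩, ?_⟩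
    · omega
    · rw [card_product, hi, hj]
      rcases hn with ⟨rfl, rfl⟩ | ⟨rfl, rfl⟩ <;> ring
  · rintro ⟨⟨i, j⟩, WA, WB⟩ hs ⟨⟨i', j'⟩, WA', WB'⟩ hs' heq
    simp only [coe_sigma, Set.mem_sigma_iff, mem_coe, mem_insert, mem_singleton, mem_product,
      mem_simplexFaces, Prod.mk.injEq] at hs hs' heq
    obtain ⟨hn, ⟨hA, hi⟩, hB, hj⟩ := hs
    obtain ⟨hn', ⟨hA', hi'⟩, hB', hj'⟩ := hs'
    have nA : WA.Nonempty := card_pos.1 (by omega)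
    have nB : WB.Nonempty := card_pos.1 (by omega)
    have nA' : WA'.Nonempty := card_pos.1 (by omega)
    have nB' : WB'.Nonempty := card_pos.1 (by omega)
    have e1 : WA = WA' := by
      rw [← product_image_fst (s := WA) nB, heq, product_image_fst nB']
    have e2 : WB = WB' := by
      rw [← product_image_snd (t := WB) nA, heq, product_image_snd nA']
    subst e1 e2 hi hj hi' hj'
    rfl
  · intro W hW
    rw [mem_coe, mem_simplexFaces] at hW
    obtain ⟨hW, hn⟩ := hW
    have e := hW.face.eq_product
    obtain ⟨⟨x, y⟩, hp⟩ : W.Nonempty := card_pos.1 (by omega)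
    have hsub := hW.face.subset
    have hx : x ∈ W.image Prod.fst := mem_image_of_mem _ hp
    have hy : y ∈ W.image Prod.snd := mem_image_of_mem _ hp
    have hxy := mem_product.1 (hsub hp)
    generalize W.image Prod.fst = WA at *
    generalize W.image Prod.snd = WB at *
    subst e
    refine ⟨⟨(#WA, #WB), WA, WB⟩, ?_, rfl⟩
    simp only [coe_sigma, Set.mem_sigma_iff, mem_coe, mem_insert, mem_singleton, mem_product,
      mem_simplexFaces, Prod.mk.injEq]
    refine ⟨?_, ⟨hW.fst_of_product hy hxy.2, trivial⟩, hW.snd_of_product hx hxy.1, trivial⟩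
    rw [card_product] at hn
    have := card_pos.2 ⟨x, hx⟩
    have := card_pos.2 ⟨y, hy⟩
    rcases card_le_one_or_of_affineIndependent_product hW.indep with h | h
    · have h1 : #WA = 1 := by omega
      rw [h1] at hn ⊢
      omega
    · have h1 : #WB = 1 := by omega
      rw [h1] at hn ⊢
      omega

end SumsOfVertexSets

section SimplexFaceCount

/-! ### Simplex faces of a convex hull -/

section

variable {E : Type*} [AddCommGroup E] [Module ℝ E]

theorem affineMap_nonpos_of_mem_convexHull {s : Set E} (g : E →ᵃ[ℝ] ℝ) (hg : ∀ x ∈ s, g x ≤ 0)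
    {x : E} (hx : x ∈ convexHull ℝ s) : g x ≤ 0 := by
  have : convexHull ℝ s ⊆ g ⁻¹' Set.Iic 0 :=
    convexHull_min hg ((convex_Iic (0 : ℝ)).affine_preimage g)
  exact this hx

/-- The points of a convex hull on a supporting hyperplane are in the convex hull of the generators
on that hyperplane. -/
theorem mem_convexHull_filter_of_affineMap_eq_zero {V : Finset E} (g : E →ᵃ[ℝ] ℝ)
    (hg : ∀ x ∈ V, g x ≤ 0) {x : E} (hx : x ∈ convexHull ℝ (V : Set E)) (h0 : g x = 0) :
    x ∈ convexHull ℝ (({y ∈ V | g y = 0} : Finset E) : Set E) := by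
  obtain ⟨w, hw, hw1, rfl⟩ := mem_convexHull'.1 hx
  have hgx : g (∑ y ∈ V, w y • y) = ∑ y ∈ V, w y * g y := by
    have hd : ∀ y, g y = g.linear y + g 0 := fun y => congrFun g.decomp y
    rw [hd, map_sum, ← one_mul (g 0), ← hw1, sum_mul, ← sum_add_distrib]
    refine sum_congr rfl fun y _ => ?_
    rw [map_smul, smul_eq_mul, ← mul_add, ← hd]
  rw [hgx, sum_eq_zero_iff_of_nonpos fun y hy =>
    mul_nonpos_of_nonneg_of_nonpos (hw y hy) (hg y hy)] at h0
  have hz : ∀ y ∈ V, y ∉ ({y ∈ V | g y = 0} : Finset E) → w y = 0 := fun y hy hy' =>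
    (mul_eq_zero.1 (h0 y hy)).resolve_right fun h => hy' (mem_filter.2 ⟨hy, h⟩)
  refine mem_convexHull'.2 ⟨w, fun y hy => hw y (mem_filter.1 hy).1, ?_, ?_⟩
  · rw [← hw1]
    exact sum_subset (filter_subset _ _) hz
  · exact sum_subset (filter_subset _ _) fun y hy hy' => by rw [hz y hy hy', zero_smul]

/-- A vertex of the convex hull of `V` that lies in the convex hull of a part of that polytope is
one of the generators of the part. -/
theorem mem_of_mem_convexHull_of_isFaceVertexSet {V s : Finset E} {x : E}
    (hx : IsFaceVertexSet V {x}) (hs : ∀ y ∈ s, y ∈ convexHull ℝ (V : Set E))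
    (hxs : x ∈ convexHull ℝ (s : Set E)) : x ∈ s := by
  obtain ⟨g, hg, hW⟩ := hx
  have hgs : ∀ y ∈ s, g y ≤ 0 := fun y hy => affineMap_nonpos_of_mem_convexHull g hg (hs y hy)
  have h0 : g x = 0 := ((hW x).1 (mem_singleton_self x)).2
  have hmem := mem_convexHull_filter_of_affineMap_eq_zero g hgs hxs h0
  obtain ⟨y, hy⟩ : ({y ∈ s | g y = 0} : Finset E).Nonempty := by
    rw [← coe_nonempty, ← convexHull_nonempty_iff (𝕜 := ℝ)]
    exact ⟨x, hmem⟩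
  rw [mem_filter] at hy
  have hyV := mem_convexHull_filter_of_affineMap_eq_zero g hg (hs y hy.1) hy.2
  have hfil : ({y ∈ V | g y = 0} : Finset E) = {x} := by
    ext z
    rw [mem_filter, hW]
  rw [hfil, coe_singleton, convexHull_singleton, Set.mem_singleton_iff] at hyV
  exact hyV ▸ hy.1

/-- A vertex of a simplex is not a convex combination of other vertices. -/
theorem range_subset_of_subset_convexHull {n : ℕ} {v : Fin n → E} (hv : AffineIndependent ℝ v)
    {s : Set E} (hs : s ⊆ Set.range v) (hvs : Set.range v ⊆ convexHull ℝ s) :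
    Set.range v ⊆ s := by
  rintro _ ⟨i, rfl⟩
  by_contra hi
  have hsub : s ⊆ v '' (Set.univ \ {i}) := by
    intro y hy
    obtain ⟨j, rfl⟩ := hs hy
    refine ⟨j, ⟨trivial, ?_⟩, rfl⟩
    rintro rfl
    exact hi hy
  exact hv.notMem_affineSpan_sdiff i Set.univ
    (affineSpan_mono ℝ hsub (convexHull_subset_affineSpan s (hvs ⟨i, rfl⟩)))

end

variable {ι : Type*} [Finite ι]

/-- Simplex faces of a polytope correspond to their vertex sets. -/
theorem simplexFaceCount_convexHull (V : Finset (ι → ℝ)) (hV : ∀ x ∈ V, IsFaceVertexSet V {x})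
    (k : ℕ) : simplexFaceCount (convexHull ℝ (V : Set (ι → ℝ))) k = #(simplexFaces V (k + 1)) := by
  have hinj : Set.InjOn (fun W : Finset (ι → ℝ) => convexHull ℝ (W : Set (ι → ℝ)))
      (simplexFaces V (k + 1)) := by
    have key : ∀ W₁ W₂ : Finset (ι → ℝ), W₁ ⊆ V → W₂ ⊆ V →
        convexHull ℝ (W₁ : Set (ι → ℝ)) = convexHull ℝ (W₂ : Set (ι → ℝ)) → W₁ ⊆ W₂ := by
      intro W₁ W₂ h₁ h₂ h x hx
      refine mem_of_mem_convexHull_of_isFaceVertexSet (hV x (h₁ hx))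
        (fun y hy => subset_convexHull ℝ _ (h₂ hy)) ?_
      rw [← h]
      exact subset_convexHull ℝ _ hx
    intro W₁ h₁ W₂ h₂ h
    have s₁ := (mem_simplexFaces.1 h₁).1.face.subset
    have s₂ := (mem_simplexFaces.1 h₂).1.face.subset
    exact Subset.antisymm (key _ _ s₁ s₂ h) (key _ _ s₂ s₁ h.symm)
  rw [simplexFaceCount, ← Set.encard_coe_eq_coe_finsetCard, ← hinj.encard_image]
  congr 1
  ext F
  constructor
  · rintro ⟨hexp, v, hv, hF⟩
    have hne : F.Nonempty := by
      rw [hF]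
      exact (Set.range_nonempty v).convexHull
    obtain ⟨l, hl⟩ := hexp hne
    obtain ⟨z, hz⟩ := hne
    have hzK : z ∈ convexHull ℝ (V : Set (ι → ℝ)) := by
      rw [hl] at hz
      exact hz.1
    have hmax : ∀ y ∈ convexHull ℝ (V : Set (ι → ℝ)), l y ≤ l z := by
      rw [hl] at hz
      exact hz.2
    let g : (ι → ℝ) →ᵃ[ℝ] ℝ :=
      (l : (ι → ℝ) →ₗ[ℝ] ℝ).toAffineMap - AffineMap.const ℝ (ι → ℝ) (l z)
    have hgv : ∀ y, g y = l y - l z := fun y => rfl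
    have hg : ∀ y ∈ V, g y ≤ 0 := fun y hy => by
      rw [hgv]
      linarith [hmax y (subset_convexHull ℝ _ hy)]
    have hFmem : ∀ y, y ∈ F ↔ y ∈ convexHull ℝ (V : Set (ι → ℝ)) ∧ g y = 0 := by
      intro y
      rw [hgv, sub_eq_zero]
      constructor
      · intro hy
        rw [hl] at hy
        exact ⟨hy.1, le_antisymm (hmax y hy.1) (hy.2 z hzK)⟩
      · rintro ⟨hy, he⟩
        rw [hl]
        exact ⟨hy, fun x hx => he ▸ hmax x hx⟩
    have hFW : F = convexHull ℝ (({y ∈ V | g y = 0} : Finset (ι → ℝ)) : Set (ι → ℝ)) := by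
      apply Set.Subset.antisymm
      · intro y hy
        rw [hFmem] at hy
        exact mem_convexHull_filter_of_affineMap_eq_zero g hg hy.1 hy.2
      · refine convexHull_min (fun y hy => ?_) (hF ▸ convex_convexHull ℝ _)
        rw [mem_coe, mem_filter] at hy
        exact (hFmem y).2 ⟨subset_convexHull ℝ _ hy.1, hy.2⟩
    -- The vertex set found from the supporting function is the given set of affinely
    -- independent points.
    set W : Finset (ι → ℝ) := {y ∈ V | g y = 0} with hW
    have hvF : Set.range v ⊆ F := hF ▸ subset_convexHull ℝ _
    have hWv : (W : Set (ι → ℝ)) ⊆ Set.range v := by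
      intro x hx
      have hxV : x ∈ V := (mem_filter.1 hx).1
      have := mem_of_mem_convexHull_of_isFaceVertexSet (s := (Set.range v).toFinset) (hV x hxV)
        (fun y hy => ((hFmem y).1 (hvF (Set.mem_toFinset.1 hy))).1)
        (by
          rw [Set.coe_toFinset, ← hF, hFW]
          exact subset_convexHull ℝ _ hx)
      exact Set.mem_toFinset.1 this
    have hWr : (W : Set (ι → ℝ)) = Set.range v :=
      Set.Subset.antisymm hWv (range_subset_of_subset_convexHull hv hWv (hFW ▸ hvF))
    refine ⟨W, ?_, hFW.symm⟩
    rw [mem_coe, mem_simplexFaces]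
    refine ⟨⟨⟨g, hg, fun x => mem_filter⟩, ?_⟩, ?_⟩
    · have := hv.range
      rw [← hWr] at this
      exact this
    · rw [← Set.ncard_coe_finset, hWr, ← Set.image_univ,
        Set.ncard_image_of_injective _ hv.injective, Set.ncard_univ, Nat.card_fin]
  · rintro ⟨W, hW, rfl⟩
    rw [mem_coe, mem_simplexFaces] at hW
    obtain ⟨⟨⟨g, hg, hgW⟩, hind⟩, hcard⟩ := hW
    refine ⟨fun _ => ⟨LinearMap.toContinuousLinearMap g.linear, ?_⟩, ?_⟩
    · have hd : ∀ y, g y = g.linear y + g 0 := fun y => congrFun g.decomp y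
      obtain ⟨z, hz⟩ : W.Nonempty := card_pos.1 (by omega)
      have hWfil : W = {y ∈ V | g y = 0} := by
        ext y
        rw [mem_filter, hgW]
      have hzV := (hgW z).1 hz
      ext x
      simp only [Set.mem_ofPred_eq, LinearMap.coe_toContinuousLinearMap']
      constructor
      · intro hx
        have hxV := convexHull_mono (𝕜 := ℝ) (coe_subset.2 fun y hy => ((hgW y).1 hy).1) hx
        refine ⟨hxV, fun y hy => ?_⟩
        have h1 := affineMap_nonpos_of_mem_convexHull g hg hy
        have h2 : (-g) x ≤ 0 := affineMap_nonpos_of_mem_convexHull (-g)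
          (fun y hy => by
            change -g y ≤ 0
            rw [((hgW y).1 hy).2, neg_zero]) hx
        have h2 : -g x ≤ 0 := h2
        rw [hd] at h1 h2
        linarith
      · rintro ⟨hx, hmax⟩
        have h1 := affineMap_nonpos_of_mem_convexHull g hg hx
        have h2 := hmax z (subset_convexHull ℝ _ hzV.1)
        have h3 := hzV.2
        have h0 : g x = 0 := by
          rw [hd] at h1 h3 ⊢
          linarith
        rw [hWfil]
        exact mem_convexHull_filter_of_affineMap_eq_zero g hg hx h0
    · let e := (W.equivFinOfCardEq hcard).symm
      refine ⟨fun i => e i, hind.comp_embedding e.toEmbedding, ?_⟩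
      have hrange : (W : Set (ι → ℝ)) = Set.range fun i => (e i : ι → ℝ) := by
        ext x
        refine ⟨fun hx => ?_, ?_⟩
        · exact ⟨e.symm ⟨x, hx⟩, by simp⟩
        · rintro ⟨i, rfl⟩
          exact (e i).2
      exact congrArg (convexHull ℝ) hrange

/-- Every vector `x` of a set of `0`-`1`-vectors is a vertex of the convex hull: the function
`∑ p, (2 * x p - 1) * (y p - x p)` of `y` is minus the number of coordinates where `y` differs from
`x`. -/
theorem isFaceVertexSet_singleton {V : Finset (ι → ℝ)} (hV : ∀ x ∈ V, ∀ p, x p = 0 ∨ x p = 1)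
    {x : ι → ℝ} (hx : x ∈ V) : IsFaceVertexSet V {x} := by
  have := Fintype.ofFinite ι
  let g : (ι → ℝ) →ᵃ[ℝ] ℝ := (∑ p, (2 * x p - 1) • LinearMap.proj (R := ℝ) p).toAffineMap -
    AffineMap.const ℝ (ι → ℝ) (∑ p, (2 * x p - 1) * x p)
  have hg : ∀ y, g y = ∑ p, (2 * x p - 1) * (y p - x p) := by
    intro y
    change (∑ p, (2 * x p - 1) • LinearMap.proj (R := ℝ) p : (ι → ℝ) →ₗ[ℝ] ℝ) y -
      ∑ p, (2 * x p - 1) * x p = _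
    simp [LinearMap.sum_apply, mul_sub]
  have hterm : ∀ y ∈ V, ∀ p, (2 * x p - 1) * (y p - x p) ≤ 0 := by
    intro y hy p
    rcases hV x hx p with h | h <;> rcases hV y hy p with h' | h' <;> norm_num [h, h']
  refine ⟨g, fun y hy => ?_, fun y => ?_⟩
  · rw [hg]
    exact sum_nonpos fun p _ => hterm y hy p
  · rw [mem_singleton, hg]
    constructor
    · rintro rfl
      exact ⟨hx, by simp⟩
    · rintro ⟨hy, h0⟩
      rw [sum_eq_zero_iff_of_nonpos fun p _ => hterm y hy p] at h0
      ext p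
      have := h0 p (mem_univ p)
      rcases hV x hx p with h | h <;> rcases hV y hy p with h' | h' <;> rw [h, h'] at this ⊢ <;>
        norm_num at this

end SimplexFaceCount

section Polytopes

/-! ### The vertices of order polytopes and chain polytopes -/

/-- A vector of lengths of subintervals of `(0, 1]` is a convex combination of the indicator
vectors that record which of the intervals contain `t`, namely the average over `t`. -/
theorem sub_mem_convexHull_of_forall_indicator_mem {ι : Type*} [Finite ι] {V : Finset (ι → ℝ)}
    {a b : ι → ℝ}
    (ha : ∀ p, 0 ≤ a p) (hab : ∀ p, a p ≤ b p) (hb : ∀ p, b p ≤ 1)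
    (h : ∀ t ∈ Set.Ioc (0 : ℝ) 1,
      (fun p => (Set.Ioc (a p) (b p)).indicator (fun _ => (1 : ℝ)) t) ∈ V) :
    b - a ∈ convexHull ℝ (V : Set (ι → ℝ)) := by
  have := Fintype.ofFinite ι
  let μ : MeasureTheory.Measure ℝ := MeasureTheory.volume.restrict (Set.Ioc 0 1)
  have hμ : MeasureTheory.IsProbabilityMeasure μ := ⟨by simp [μ]⟩
  let f : ℝ → ι → ℝ := fun t p => (Set.Ioc (a p) (b p)).indicator (fun _ => (1 : ℝ)) t
  have hint : ∀ p, MeasureTheory.Integrable (fun t => f t p) μ := fun p =>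
    (MeasureTheory.integrable_const (1 : ℝ)).indicator measurableSet_Ioc
  have hmem : (∫ t, f t ∂μ) ∈ convexHull ℝ (V : Set (ι → ℝ)) := by
    refine (convex_convexHull ℝ _).integral_mem (V.finite_toSet.isClosed_convexHull ℝ) ?_
      (MeasureTheory.Integrable.of_eval hint)
    exact MeasureTheory.ae_restrict_of_forall_mem measurableSet_Ioc fun t ht =>
      subset_convexHull ℝ _ (h t ht)
  convert hmem using 1
  ext p
  rw [MeasureTheory.eval_integral hint]
  change _ = ∫ t, (Set.Ioc (a p) (b p)).indicator (fun _ => (1 : ℝ)) t ∂μ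
  rw [MeasureTheory.integral_indicator measurableSet_Ioc,
    MeasureTheory.Measure.restrict_restrict measurableSet_Ioc,
    Set.inter_eq_left.2 (Set.Ioc_subset_Ioc (ha p) (hb p))]
  simp [hab p]

theorem finite_setOf_zero_one (P : Type*) [Finite P] :
    {x : P → ℝ | ∀ p, x p = 0 ∨ x p = 1}.Finite :=
  Set.Finite.pi' (t := fun _ : P => ({0, 1} : Set ℝ)) fun _ => Set.toFinite _

/-- The vertices of the order polytope, that is, the indicator functions of the up-sets. -/
noncomputable def orderVertices (P : Type*) [PartialOrder P] [Finite P] : Finset (P → ℝ) :=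
  ((finite_setOf_zero_one P).subset
    (fun _ hx => hx.1 : {x : P → ℝ | (∀ p, x p = 0 ∨ x p = 1) ∧ Monotone x} ⊆ _)).toFinset

/-- The vertices of the chain polytope, that is, the indicator functions of the antichains. -/
noncomputable def chainVertices (P : Type*) [PartialOrder P] [Finite P] : Finset (P → ℝ) :=
  ((finite_setOf_zero_one P).subset
    (fun _ hx => hx.1 : {x : P → ℝ | (∀ p, x p = 0 ∨ x p = 1) ∧
      ∀ p q, p < q → x p = 0 ∨ x q = 0} ⊆ _)).toFinset

variable {P : Type*} [PartialOrder P] [Finite P]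

theorem mem_orderVertices {x : P → ℝ} :
    x ∈ orderVertices P ↔ (∀ p, x p = 0 ∨ x p = 1) ∧ Monotone x := by
  simp [orderVertices]

theorem mem_chainVertices {x : P → ℝ} :
    x ∈ chainVertices P ↔ (∀ p, x p = 0 ∨ x p = 1) ∧ ∀ p q, p < q → x p = 0 ∨ x q = 0 := by
  simp [chainVertices]

theorem convex_orderPolytope (P : Type*) [PartialOrder P] : Convex ℝ (orderPolytope P) := by
  intro x hx y hy s t hs ht hst
  refine ⟨fun p => ⟨?_, ?_⟩, fun p q hpq => ?_⟩ <;>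
    simp only [Pi.add_apply, Pi.smul_apply, smul_eq_mul]
  · exact add_nonneg (mul_nonneg hs (hx.1 p).1) (mul_nonneg ht (hy.1 p).1)
  · nlinarith [mul_le_mul_of_nonneg_left (hx.1 p).2 hs, mul_le_mul_of_nonneg_left (hy.1 p).2 ht]
  · exact add_le_add (mul_le_mul_of_nonneg_left (hx.2 p q hpq) hs)
      (mul_le_mul_of_nonneg_left (hy.2 p q hpq) ht)

theorem convex_chainPolytope (P : Type*) [PartialOrder P] : Convex ℝ (chainPolytope P) := by
  intro x hx y hy s t hs ht hst
  refine ⟨fun p => ?_, fun c hc => ?_⟩ <;>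
    simp only [Pi.add_apply, Pi.smul_apply, smul_eq_mul]
  · exact add_nonneg (mul_nonneg hs (hx.1 p)) (mul_nonneg ht (hy.1 p))
  · rw [sum_add_distrib, ← mul_sum, ← mul_sum]
    nlinarith [mul_le_mul_of_nonneg_left (hx.2 c hc) hs, mul_le_mul_of_nonneg_left (hy.2 c hc) ht]

theorem orderPolytope_eq_convexHull :
    orderPolytope P = convexHull ℝ (orderVertices P : Set (P → ℝ)) := by
  apply Set.Subset.antisymm
  · intro x hx
    rw [← sub_zero x]
    refine sub_mem_convexHull_of_forall_indicator_mem (fun _ => le_rfl) (fun p => (hx.1 p).1)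
      (fun p => (hx.1 p).2) fun t ht => ?_
    rw [mem_orderVertices]
    refine ⟨fun p => Set.indicator_eq_zero_or_self _ _ _, fun p q hpq => ?_⟩
    refine Set.indicator_le_indicator_of_subset (fun s hs => ?_) (fun _ => zero_le_one) t
    exact ⟨hs.1, hs.2.trans (hx.2 p q hpq)⟩
  · refine convexHull_min (fun x hx => ?_) (convex_orderPolytope P)
    rw [mem_coe, mem_orderVertices] at hx
    refine ⟨fun p => ?_, fun p q hpq => hx.2 hpq⟩
    rcases hx.1 p with h | h <;> norm_num [h]

/-- The convex combination is found with Stanley's transfer map: let `b p` be the greatest sum of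
`x` over a chain below `p`. For each `t`, the `p` with `b p - x p < t ≤ b p` form an antichain. -/
theorem chainPolytope_eq_convexHull :
    chainPolytope P = convexHull ℝ (chainVertices P : Set (P → ℝ)) := by
  have := Fintype.ofFinite P
  apply Set.Subset.antisymm
  · intro x hx
    let C : P → Finset (Finset P) := fun p =>
      {c | IsChain (· ≤ ·) (c : Set P) ∧ ∀ q ∈ c, q ≤ p}
    have hC : ∀ p, (C p).Nonempty := fun p => ⟨∅, by simp [C]⟩
    let b : P → ℝ := fun p => (C p).sup' (hC p) fun c => ∑ q ∈ c, x q
    have hle : ∀ p, ∀ c ∈ C p, ∑ q ∈ c, x q ≤ b p := fun p c hc =>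
      le_sup' (fun c => ∑ q ∈ c, x q) hc
    have hex : ∀ p, ∃ c ∈ C p, b p = ∑ q ∈ c, x q := fun p =>
      exists_mem_eq_sup' (hC p) fun c => ∑ q ∈ c, x q
    have hlt : ∀ p q, p < q → b p ≤ b q - x q := by
      intro p q hpq
      obtain ⟨c, hc, hbc⟩ := hex p
      simp only [C, mem_filter, mem_univ, true_and] at hc
      have hqc : q ∉ c := fun h => (hc.2 q h).not_gt hpq
      have := hle q (insert q c) (by
        simp only [C, mem_filter, mem_univ, true_and, coe_insert]
        refine ⟨hc.1.insert fun r hr _ => Or.inr ((hc.2 r hr).trans hpq.le), fun r hr => ?_⟩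
        rcases mem_insert.1 hr with rfl | hr
        exacts [le_rfl, (hc.2 r hr).trans hpq.le])
      rw [sum_insert hqc] at this
      linarith
    have hxb : ∀ p, x p ≤ b p := fun p => by
      simpa using hle p {p} (by simp [C])
    have hb1 : ∀ p, b p ≤ 1 := fun p => by
      obtain ⟨c, hc, hbc⟩ := hex p
      simp only [C, mem_filter, mem_univ, true_and] at hc
      exact hbc ▸ hx.2 c hc.1
    have hsub : x = b - (b - x) := by simp
    rw [hsub]
    refine sub_mem_convexHull_of_forall_indicator_mem (fun p => sub_nonneg.2 (hxb p))
      (fun p => sub_le_self _ (hx.1 p)) hb1 fun t ht => ?_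
    rw [mem_chainVertices]
    refine ⟨fun p => Set.indicator_eq_zero_or_self _ _ _, fun p q hpq => ?_⟩
    by_contra! hpq'
    have h1 := Set.mem_of_indicator_ne_zero hpq'.1
    have h2 := Set.mem_of_indicator_ne_zero hpq'.2
    exact (h1.2.trans (hlt p q hpq)).not_gt h2.1
  · refine convexHull_min (fun x hx => ?_) (convex_chainPolytope P)
    rw [mem_coe, mem_chainVertices] at hx
    have h01 : ∀ p, 0 ≤ x p ∧ x p ≤ 1 := fun p => by
      rcases hx.1 p with h | h <;> norm_num [h]
    refine ⟨fun p => (h01 p).1, fun c hc => ?_⟩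
    by_cases hall : ∀ p ∈ c, x p = 0
    · rw [sum_eq_zero hall]
      exact zero_le_one
    · push Not at hall
      obtain ⟨p, hp, hxp⟩ := hall
      rw [sum_eq_single_of_mem p hp]
      · exact (h01 p).2
      · intro q hq hqp
        rcases (hc.total hq hp).imp (lt_of_le_of_ne · hqp) (lt_of_le_of_ne · hqp.symm) with h | h
        · exact (hx.2 q p h).resolve_right hxp
        · exact (hx.2 p q h).resolve_left hxp

theorem simplexFaceCount_orderPolytope (k : ℕ) :
    simplexFaceCount (orderPolytope P) k = #(simplexFaces (orderVertices P) (k + 1)) := by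
  rw [orderPolytope_eq_convexHull, simplexFaceCount_convexHull]
  exact fun x hx => isFaceVertexSet_singleton (fun y hy => (mem_orderVertices.1 hy).1) hx

theorem simplexFaceCount_chainPolytope (k : ℕ) :
    simplexFaceCount (chainPolytope P) k = #(simplexFaces (chainVertices P) (k + 1)) := by
  rw [chainPolytope_eq_convexHull, simplexFaceCount_convexHull]
  exact fun x hx => isFaceVertexSet_singleton (fun y hy => (mem_chainVertices.1 hy).1) hx

end Polytopes

section XFree

/-! ### `X`-free posets -/

variable {P : Type*} [PartialOrder P]

/-- In an `X`-free poset, the elements above `c` form a chain unless those below `c` do. -/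
theorem XFree.isChain_Ioi (h : XFree P) {c : P} (hc : ¬ IsChain (· ≤ ·) (Set.Iio c)) :
    IsChain (· ≤ ·) (Set.Ioi c) := by
  by_contra hc'
  simp only [IsChain, Set.Pairwise, not_forall] at hc hc'
  obtain ⟨a, ha, b, hb, -, hab⟩ := hc
  obtain ⟨d, hd, e, he, -, hde⟩ := hc'
  rw [not_or] at hab hde
  rw [Set.mem_Iio] at ha hb
  rw [Set.mem_Ioi] at hd he
  refine h.false (OrderEmbedding.ofMapLEIff (fun x => Sum.elim
    (fun y => Sum.elim (fun z => Sum.elim (fun _ => a) (fun _ => b) z) (fun _ => c) (ofLex y))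
    (fun z => Sum.elim (fun _ => d) (fun _ => e) z) (ofLex x)) ?_)
  have := ha.le; have := hb.le; have := hd.le; have := he.le
  have := (ha.trans hd).le; have := (ha.trans he).le
  have := (hb.trans hd).le; have := (hb.trans he).le
  have := ha.not_ge; have := hb.not_ge; have := hd.not_ge; have := he.not_ge
  have := (ha.trans hd).not_ge; have := (ha.trans he).not_ge
  have := (hb.trans hd).not_ge; have := (hb.trans he).not_ge
  have hx : ∀ x : PosetX, x = toLex (Sum.inl (toLex (Sum.inl (Sum.inl ())))) ∨
      x = toLex (Sum.inl (toLex (Sum.inl (Sum.inr ())))) ∨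
      x = toLex (Sum.inl (toLex (Sum.inr ()))) ∨
      x = toLex (Sum.inr (Sum.inl ())) ∨ x = toLex (Sum.inr (Sum.inr ())) := by
    intro x
    rcases x with (((_ | _) | _) | (_ | _)) <;> tauto
  intro x y
  rcases hx x with rfl | rfl | rfl | rfl | rfl <;> rcases hx y with rfl | rfl | rfl | rfl | rfl <;>
    simp [*]

/-- A chain contains at most one element of an antichain. -/
theorem sum_eq_zero_or_one_of_isChain [Finite P] {y : P → ℝ} (hy : y ∈ chainVertices P)
    {s : Finset P}
    (hs : IsChain (· ≤ ·) (s : Set P)) :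
    (∑ p ∈ s, y p = 1 ∧ ∃ p ∈ s, y p = 1) ∨ (∑ p ∈ s, y p = 0 ∧ ∀ p ∈ s, y p = 0) := by
  rw [mem_chainVertices] at hy
  by_cases hall : ∀ p ∈ s, y p = 0
  · exact Or.inr ⟨sum_eq_zero hall, hall⟩
  · push Not at hall
    obtain ⟨p, hp, hyp⟩ := hall
    have h1 := (hy.1 p).resolve_left hyp
    refine Or.inl ⟨?_, p, hp, h1⟩
    rw [← h1]
    refine sum_eq_single_of_mem p hp fun q hq hqp => ?_
    rcases (hs.total hq hp).imp (lt_of_le_of_ne · hqp) (lt_of_le_of_ne · hqp.symm) with h | h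
    · exact (hy.2 q p h).resolve_right hyp
    · exact (hy.2 p q h).resolve_left hyp

/-- The affine map that carries the chain polytope of an `X`-free poset to the order polytope. A
coordinate is the sum over the elements below it if these form a chain; otherwise it is `1` minus
the sum over the elements above it. -/
noncomputable def chainToOrder (P : Type*) [PartialOrder P] [Fintype P] :
    (P → ℝ) →ᵃ[ℝ] (P → ℝ) :=
  (LinearMap.pi fun c => if IsChain (· ≤ ·) (Set.Iio c) then
    ∑ d with d ≤ c, LinearMap.proj (R := ℝ) (φ := fun _ : P => ℝ) d
    else -∑ d with c ≤ d, LinearMap.proj (R := ℝ) (φ := fun _ : P => ℝ) d :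
    (P → ℝ) →ₗ[ℝ] (P → ℝ)).toAffineMap +
  AffineMap.const ℝ (P → ℝ) (fun c => if IsChain (· ≤ ·) (Set.Iio c) then 0 else 1 : P → ℝ)

theorem chainToOrder_apply_of_isChain [Fintype P] (y : P → ℝ) {c : P}
    (hc : IsChain (· ≤ ·) (Set.Iio c)) : chainToOrder P y c = ∑ d with d ≤ c, y d := by
  simp [chainToOrder, hc, LinearMap.sum_apply]

theorem chainToOrder_apply_of_not_isChain [Fintype P] (y : P → ℝ) {c : P}
    (hc : ¬ IsChain (· ≤ ·) (Set.Iio c)) : chainToOrder P y c = 1 - ∑ d with c ≤ d, y d := by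
  simp [chainToOrder, hc, LinearMap.sum_apply]
  ring

/-- Antichains are carried to up-sets: if `d ≤ c < c' ≤ e`, where the elements below `c` form a
chain and those below `c'` do not, then an antichain does not contain both `d` and `e`. An up-set comes
from its minimal elements among the `c` that have a chain below them, and the maximal elements of
its complement among the other `c`. -/
theorem XFree.bijOn_chainToOrder [Fintype P] (h : XFree P) :
    Set.BijOn (chainToOrder P) (chainVertices P) (orderVertices P) := by
  set T := chainToOrder P with hT
  let D : P → Prop := fun c => IsChain (· ≤ ·) (Set.Iio c)
  have hDle : ∀ {c d}, D c → d ≤ c → D d := fun hc hd => hc.mono (Set.Iio_subset_Iio hd)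
  have hlow : ∀ {y}, y ∈ chainVertices P → ∀ {c}, D c →
      (T y c = 1 ∧ ∃ d, d ≤ c ∧ y d = 1) ∨ (T y c = 0 ∧ ∀ d, d ≤ c → y d = 0) := by
    intro y hy c hc
    have hch : IsChain (· ≤ ·) (({d | d ≤ c} : Finset P) : Set P) := by
      have : (({d | d ≤ c} : Finset P) : Set P) = insert c (Set.Iio c) := by
        ext d
        simp [le_iff_eq_or_lt]
      rw [this]
      exact hc.insert fun d hd _ => Or.inr (le_of_lt hd)
    have := sum_eq_zero_or_one_of_isChain hy hch
    rw [← chainToOrder_apply_of_isChain y hc] at this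
    simpa using this
  have hup : ∀ {y}, y ∈ chainVertices P → ∀ {c}, ¬ D c →
      (T y c = 0 ∧ ∃ d, c ≤ d ∧ y d = 1) ∨ (T y c = 1 ∧ ∀ d, c ≤ d → y d = 0) := by
    intro y hy c hc
    have hch : IsChain (· ≤ ·) (({d | c ≤ d} : Finset P) : Set P) := by
      have : (({d | c ≤ d} : Finset P) : Set P) = insert c (Set.Ioi c) := by
        ext d
        simp [le_iff_eq_or_lt]
      rw [this]
      exact (h.isChain_Ioi hc).insert fun d hd _ => Or.inl (le_of_lt hd)
    have h1 := chainToOrder_apply_of_not_isChain y hc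
    have := sum_eq_zero_or_one_of_isChain hy hch
    simp only [mem_filter, mem_univ, true_and] at this
    refine this.imp (fun h => ⟨?_, h.2⟩) (fun h => ⟨?_, h.2⟩)
    · rw [hT, h1, h.1, sub_self]
    · rw [hT, h1, h.1, sub_zero]
  -- The antichain that corresponds to an up-set.
  let C : (P → ℝ) → P → Prop := fun x c =>
    (D c ∧ x c = 1 ∧ ∀ d, d < c → x d = 0) ∨ (¬ D c ∧ x c = 0 ∧ ∀ d, c < d → x d = 1)
  have hrec : ∀ {y}, y ∈ chainVertices P → ∀ c, y c = 1 ↔ C (T y) c := by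
    intro y hy c
    have hanti := (mem_chainVertices.1 hy).2
    by_cases hc : D c
    · simp only [C, hc, not_true, true_and, false_and, or_false]
      constructor
      · intro hyc
        refine ⟨?_, fun d hd => ?_⟩
        · rcases hlow hy hc with h | h
          · exact h.1
          · exact absurd (h.2 c le_rfl) (by simp [hyc])
        · rcases hlow hy (hDle hc hd.le) with ⟨-, e, he, hye⟩ | h
          · rcases hanti e c (he.trans_lt hd) with h0 | h0 <;> simp_all
          · exact h.1
      · rintro ⟨h1, h2⟩
        rcases hlow hy hc with ⟨-, d, hd, hyd⟩ | h
        · rcases hd.eq_or_lt with rfl | hlt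
          · exact hyd
          · rcases hlow hy (hDle hc hd) with h | h
            · exact absurd (h2 d hlt) (by simp [h.1])
            · exact absurd (h.2 d le_rfl) (by simp [hyd])
        · exact absurd h.1 (by simp [h1])
    · simp only [C, hc, not_false_eq_true, true_and, false_and, false_or]
      constructor
      · intro hyc
        refine ⟨?_, fun d hd => ?_⟩
        · rcases hup hy hc with h | h
          · exact h.1
          · exact absurd (h.2 c le_rfl) (by simp [hyc])
        · rcases hup hy (fun hD => hc (hDle hD hd.le)) with ⟨-, e, he, hye⟩ | h
          · rcases hanti c e (hd.trans_le he) with h0 | h0 <;> simp_all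
          · exact h.1
      · rintro ⟨h1, h2⟩
        rcases hup hy hc with ⟨-, d, hd, hyd⟩ | h
        · rcases hd.eq_or_lt with rfl | hlt
          · exact hyd
          · rcases hup hy (fun hD => hc (hDle hD hd)) with h | h
            · exact absurd (h2 d hlt) (by simp [h.1])
            · exact absurd (h.2 d le_rfl) (by simp [hyd])
        · exact absurd h.1 (by simp [h1])
  refine ⟨fun y hy => ?_, fun y hy y' hy' heq => ?_, fun x hx => ?_⟩
  · rw [mem_coe] at hy ⊢
    have hanti := (mem_chainVertices.1 hy).2
    have h01 : ∀ c, T y c = 0 ∨ T y c = 1 := fun c => by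
      by_cases hc : D c
      · exact (hlow hy hc).elim (fun h => Or.inr h.1) (fun h => Or.inl h.1)
      · exact (hup hy hc).elim (fun h => Or.inl h.1) (fun h => Or.inr h.1)
    refine mem_orderVertices.2 ⟨h01, fun c c' hcc => ?_⟩
    have key : T y c = 1 → T y c' = 1 := by
      intro h1
      by_cases hc' : D c'
      · rcases hlow hy (hDle hc' hcc) with ⟨-, d, hd, hyd⟩ | h
        · rcases hlow hy hc' with h | h
          · exact h.1
          · exact absurd (h.2 d (hd.trans hcc)) (by simp [hyd])
        · exact absurd h.1 (by simp [h1])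
      · rcases hup hy hc' with ⟨-, e, he, hye⟩ | h
        · exfalso
          by_cases hc : D c
          · rcases hlow hy hc with ⟨-, d, hd, hyd⟩ | h
            · -- `d ≤ c ≤ c' ≤ e`, and `c = c'` is impossible.
              have hlt : c < c' := lt_of_le_of_ne hcc (by rintro rfl; exact hc' hc)
              rcases hanti d e (hd.trans_lt (hlt.trans_le he)) with h0 | h0 <;> simp_all
            · exact absurd h.1 (by simp [h1])
          · rcases hup hy hc with h | h
            · exact absurd h.1 (by simp [h1])
            · exact absurd (h.2 e (hcc.trans he)) (by simp [hye])
        · exact h.1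
    rcases h01 c with h0 | h1
    · rcases h01 c' with h | h <;> norm_num [h0, h]
    · rw [h1, key h1]
  · ext c
    have hiff : y c = 1 ↔ y' c = 1 := by rw [hrec hy c, hrec hy' c, heq]
    rcases (mem_chainVertices.1 hy).1 c with h0 | h1
    · rcases (mem_chainVertices.1 hy').1 c with h0' | h1'
      · rw [h0, h0']
      · rw [hiff.2 h1', h1']
    · rw [h1, hiff.1 h1]
  · rw [mem_coe, mem_orderVertices] at hx
    obtain ⟨hx01, hmono⟩ := hx
    let y : P → ℝ := fun c => if C x c then 1 else 0
    have hy1 : ∀ {c}, C x c → y c = 1 := fun h => if_pos h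
    have hy0 : ∀ {c}, ¬ C x c → y c = 0 := fun h => if_neg h
    have hy : y ∈ chainVertices P := by
      refine mem_chainVertices.2 ⟨fun c => ?_, fun p q hpq => ?_⟩
      · by_cases hc : C x c
        exacts [Or.inr (hy1 hc), Or.inl (hy0 hc)]
      · by_contra! hne
        have hp : C x p := by by_contra hn; exact hne.1 (hy0 hn)
        have hq : C x q := by by_contra hn; exact hne.2 (hy0 hn)
        have hxpq := hmono hpq.le
        rcases hp with ⟨hDp, hp1, hp2⟩ | ⟨hDp, hp1, hp2⟩ <;>
          rcases hq with ⟨hDq, hq1, hq2⟩ | ⟨hDq, hq1, hq2⟩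
        · exact absurd (hq2 p hpq) (by simp [hp1])
        · rw [hp1, hq1] at hxpq
          norm_num at hxpq
        · exact hDp (hDle hDq hpq.le)
        · exact absurd (hp2 q hpq) (by simp [hq1])
    refine ⟨y, hy, ?_⟩
    ext c
    by_cases hc : D c
    · rcases hx01 c with h0 | h1
      · rcases hlow hy hc with ⟨-, d, hd, hyd⟩ | h
        · exfalso
          have hCd : C x d := by by_contra hn; simp [hy0 hn] at hyd
          rcases hCd with ⟨-, hd1, -⟩ | ⟨hnd, -⟩
          · have := hmono hd
            rw [hd1, h0] at this
            norm_num at this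
          · exact hnd (hDle hc hd)
        · rw [h.1, h0]
      · obtain ⟨d, hdc, hd⟩ := exists_minimal_le_of_wellFoundedLT (fun d => x d = 1) c h1
        have hCd : C x d := Or.inl ⟨hDle hc hdc, hd.prop, fun e he =>
          (hx01 e).resolve_right fun h => (hd.not_prop_of_lt he) h⟩
        rcases hlow hy hc with h | h
        · rw [h.1, h1]
        · exact absurd (h.2 d hdc) (by simp [hy1 hCd])
    · rcases hx01 c with h0 | h1
      · obtain ⟨d, hdc, hd⟩ := exists_maximal_ge_of_wellFoundedGT (fun d => x d = 0) c h0
        have hCd : C x d := Or.inr ⟨fun hD => hc (hDle hD hdc), hd.prop, fun e he =>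
          (hx01 e).resolve_left fun h => (hd.not_prop_of_gt he) h⟩
        rcases hup hy hc with h | h
        · rw [h.1, h0]
        · exact absurd (h.2 d hdc) (by simp [hy1 hCd])
      · rcases hup hy hc with ⟨-, d, hd, hyd⟩ | h
        · exfalso
          have hCd : C x d := by by_contra hn; simp [hy0 hn] at hyd
          rcases hCd with ⟨hDd, -⟩ | ⟨-, hd1, -⟩
          · exact hc (hDle hDd hd)
          · have := hmono hd
            rw [hd1, h1] at this
            norm_num at this
        · rw [h.1, h1]

theorem XFree.card_simplexFaces_le [Finite P] (h : XFree P) (n : ℕ) :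
    #(simplexFaces (orderVertices P) n) ≤ #(simplexFaces (chainVertices P) n) := by
  have := Fintype.ofFinite P
  exact card_simplexFaces_le_of_bijOn _ h.bijOn_chainToOrder n

end XFree

section FacesThroughVertices

/-! ### Chains and the simplex faces through a distinguished vertex -/

/-- The chains with `n` elements. -/
noncomputable def chainsOfCard (P : Type*) [PartialOrder P] [Finite P] (n : ℕ) :
    Finset (Finset P) :=
  (Set.toFinite {S : Finset P | IsChain (· ≤ ·) (S : Set P) ∧ #S = n}).toFinset

/-- The indicator function of a principal up-set. -/
noncomputable def upIndicator {P : Type*} [PartialOrder P] (p : P) : P → ℝ :=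
  fun q => if p ≤ q then 1 else 0

theorem upIndicator_of_le {P : Type*} [PartialOrder P] {p q : P} (h : p ≤ q) : upIndicator p q = 1 :=
  if_pos h

theorem upIndicator_of_not_le {P : Type*} [PartialOrder P] {p q : P} (h : ¬ p ≤ q) :
    upIndicator p q = 0 := if_neg h

theorem upIndicator_injective {P : Type*} [PartialOrder P] :
    Function.Injective (upIndicator (P := P)) := by
  have key : ∀ p q : P, upIndicator p = upIndicator q → q ≤ p := by
    intro p q h
    by_contra hn
    have := congrFun h p
    rw [upIndicator_of_le le_rfl, upIndicator_of_not_le hn] at this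
    norm_num at this
  exact fun p q h => le_antisymm (key q p h.symm) (key p q h)

theorem upIndicator_ne_zero {P : Type*} [PartialOrder P] (p : P) : upIndicator p ≠ 0 := fun h => by
  have := congrFun h p
  rw [upIndicator_of_le le_rfl] at this
  norm_num at this

variable {P : Type*} [PartialOrder P] [Finite P]

theorem mem_chainsOfCard {n : ℕ} {S : Finset P} :
    S ∈ chainsOfCard P n ↔ IsChain (· ≤ ·) (S : Set P) ∧ #S = n := by
  simp [chainsOfCard]

theorem zero_mem_chainVertices : (0 : P → ℝ) ∈ chainVertices P := by
  simp [mem_chainVertices]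

theorem zero_mem_orderVertices : (0 : P → ℝ) ∈ orderVertices P := by
  simp only [mem_orderVertices, Pi.zero_apply, true_or, implies_true, true_and]
  exact fun _ _ _ => le_rfl

theorem one_mem_orderVertices : (1 : P → ℝ) ∈ orderVertices P := by
  simp only [mem_orderVertices, Pi.one_apply, or_true, implies_true, true_and]
  exact fun _ _ _ => le_rfl

theorem single_mem_chainVertices (p : P) : (Pi.single p 1 : P → ℝ) ∈ chainVertices P := by
  refine mem_chainVertices.2 ⟨fun q => ?_, fun q r hqr => ?_⟩
  · by_cases h : q = p
    · subst h; simp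
    · simp [h]
  · by_cases h : q = p
    · subst h
      exact Or.inr (by simp [hqr.ne'])
    · exact Or.inl (by simp [h])

/-- A face of the chain polytope through the origin is closed under taking parts of an
antichain. -/
theorem IsFaceVertexSet.mem_of_add_mem {W : Finset (P → ℝ)}
    (h : IsFaceVertexSet (chainVertices P) W) (h0 : (0 : P → ℝ) ∈ W) {x y : P → ℝ}
    (hx : x ∈ chainVertices P) (hy : y ∈ chainVertices P) (hxy : x + y ∈ W) : x ∈ W := by
  obtain ⟨g, hg, hW⟩ := h
  have hd : ∀ z, g z = g.linear z + g 0 := fun z => congrFun g.decomp z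
  have e0 := ((hW _).1 h0).2
  have e1 := ((hW _).1 hxy).2
  rw [hd, map_add, e0] at e1
  have e2 := hg x hx
  have e3 := hg y hy
  refine (hW x).2 ⟨hx, ?_⟩
  rw [hd, e0] at e2 e3 ⊢
  linarith

theorem IsFaceVertexSet.add_mem {W : Finset (P → ℝ)}
    (h : IsFaceVertexSet (chainVertices P) W) (h0 : (0 : P → ℝ) ∈ W) {x y : P → ℝ}
    (hx : x ∈ W) (hy : y ∈ W) (hxy : x + y ∈ chainVertices P) : x + y ∈ W := by
  obtain ⟨g, hg, hW⟩ := h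
  have hd : ∀ z, g z = g.linear z + g 0 := fun z => congrFun g.decomp z
  have e0 := ((hW _).1 h0).2
  have e1 := ((hW _).1 hx).2
  have e2 := ((hW _).1 hy).2
  refine (hW _).2 ⟨hxy, ?_⟩
  rw [hd, e0] at e1 e2
  rw [hd, e0, map_add]
  linarith

/-- The nonzero vertices of a simplex face of the chain polytope through the origin are unit
vectors: otherwise the face contains a parallelogram. -/
theorem IsSimplexVertexSet.eq_single_of_mem {W : Finset (P → ℝ)}
    (h : IsSimplexVertexSet (chainVertices P) W) (h0 : (0 : P → ℝ) ∈ W) {x : P → ℝ}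
    (hx : x ∈ W) {p : P} (hp : x p = 1) : x = Pi.single p 1 := by
  by_contra hne
  set e : P → ℝ := Pi.single p 1 with he
  have hxV := mem_chainVertices.1 (h.face.subset hx)
  have hep : e p = 1 := by simp [he]
  have heq : ∀ q, q ≠ p → e q = 0 := fun q hq => by simp [he, hq]
  have hzero : ∀ q, x q = 0 → (x - e) q = 0 := by
    intro q hq
    have hqp : q ≠ p := by rintro rfl; rw [hp] at hq; norm_num at hq
    rw [Pi.sub_apply, hq, heq q hqp, sub_zero]
  have hsub : x - e ∈ chainVertices P := by
    refine mem_chainVertices.2 ⟨fun q => ?_, fun q r hqr =>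
      (hxV.2 q r hqr).imp (hzero q) (hzero r)⟩
    by_cases hqp : q = p
    · left; rw [hqp, Pi.sub_apply, hp, hep, sub_self]
    · rw [Pi.sub_apply, heq q hqp, sub_zero]
      exact hxV.1 q
  have heW : e ∈ W := h.face.mem_of_add_mem h0 (single_mem_chainVertices p) hsub (by simpa using hx)
  have hsW : x - e ∈ W := h.face.mem_of_add_mem h0 hsub (single_mem_chainVertices p)
    (by simpa [he] using hx)
  have hsp : (x - e) p = 0 := by rw [Pi.sub_apply, hp, hep, sub_self]
  have d1 : (0 : P → ℝ) ≠ x := fun h => by simp [← h] at hp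
  have d2 : (0 : P → ℝ) ≠ e := fun h => by simp [← h] at hep
  have d3 : (0 : P → ℝ) ≠ x - e := fun h => hne (sub_eq_zero.1 h.symm)
  have d4 : x ≠ x - e := fun h => by rw [← h, hp] at hsp; norm_num at hsp
  have d5 : e ≠ x - e := fun h => by rw [← h, hep] at hsp; norm_num at hsp
  have h4 := (affineIndependent_coe_finset_iff _).1 (affineIndependent_of_subset
    (W := {0, x, e, x - e}) h.indep (by
      intro z hz
      simp only [mem_insert, mem_singleton] at hz
      rcases hz with rfl | rfl | rfl | rfl <;> assumption))
    (fun z => if z = 0 ∨ z = x then 1 else -1)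
    (by
      rw [sum_insert (by simp [d1, d2, d3]), sum_insert (by simp [hne, d4]),
        sum_insert (by simp [d5]), sum_singleton]
      simp [d1.symm, d2.symm, d3.symm, d4.symm, Ne.symm hne])
    (by
      rw [sum_insert (by simp [d1, d2, d3]), sum_insert (by simp [hne, d4]),
        sum_insert (by simp [d5]), sum_singleton]
      simp [d1.symm, d2.symm, d3.symm, d4.symm, Ne.symm hne]
      abel)
    0 (by simp)
  simp at h4

theorem card_facesThrough_chainVertices_le (n : ℕ) :
    #(facesThrough (chainVertices P) 0 n) ≤ #(chainsOfCard P n) := by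
  have := Fintype.ofFinite P
  have key : ∀ W ∈ facesThrough (chainVertices P) 0 n,
      W = insert 0 (image (fun p => Pi.single p 1) ({p | Pi.single p 1 ∈ W} : Finset P)) := by
    intro W hW
    rw [mem_facesThrough] at hW
    obtain ⟨hW, -, h0⟩ := hW
    ext x
    simp only [mem_insert, mem_image, mem_filter, mem_univ, true_and]
    constructor
    · intro hx
      by_cases hall : ∀ p, x p = 0
      · exact Or.inl (funext hall)
      · push Not at hall
        obtain ⟨p, hp⟩ := hall
        have hp1 := ((mem_chainVertices.1 (hW.face.subset hx)).1 p).resolve_left hp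
        have := hW.eq_single_of_mem h0 hx hp1
        exact Or.inr ⟨p, this ▸ hx, this.symm⟩
    · rintro (rfl | ⟨p, hp, rfl⟩) <;> assumption
  have hsinj : Function.Injective fun p : P => (Pi.single p 1 : P → ℝ) := by
    intro p q hpq
    by_contra hne
    have := congrFun hpq p
    simp [hne] at this
  refine card_le_card_of_injOn (fun W => ({p | Pi.single p 1 ∈ W} : Finset P)) ?_ ?_
  · intro W hWm
    have hWeq := key W hWm
    rw [mem_coe, mem_facesThrough] at hWm
    obtain ⟨hW, hcard, h0⟩ := hWm
    rw [mem_coe, mem_chainsOfCard]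
    constructor
    · intro p hp q hq hpq
      by_contra hn
      rw [not_or] at hn
      rw [mem_coe, mem_filter] at hp hq
      have hV : (Pi.single p 1 + Pi.single q 1 : P → ℝ) ∈ chainVertices P := by
        refine mem_chainVertices.2 ⟨fun r => ?_, fun r s hrs => ?_⟩
        · by_cases hrp : r = p
          · subst hrp; simp [hpq]
          · by_cases hrq : r = q
            · subst hrq; simp [hrp]
            · simp [hrp, hrq]
        · by_contra! hne
          have hmem : ∀ t, (Pi.single p 1 + Pi.single q 1 : P → ℝ) t ≠ 0 → t = p ∨ t = q := by
            intro t ht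
            by_contra! hc
            simp [hc.1, hc.2] at ht
          rcases hmem r hne.1 with rfl | rfl <;> rcases hmem s hne.2 with rfl | rfl
          exacts [lt_irrefl _ hrs, hn.1 hrs.le, hn.2 hrs.le, lt_irrefl _ hrs]
      have hmem := hW.face.add_mem h0 hp.2 hq.2 hV
      have e1 := hW.eq_single_of_mem h0 hmem (p := p) (by simp [hpq])
      have e2 := congrFun e1 q
      simp [Ne.symm hpq] at e2
    · have h0n : (0 : P → ℝ) ∉
          image (fun p => Pi.single p 1) ({p | Pi.single p 1 ∈ W} : Finset P) := by
        simp
      have hc := congrArg card hWeq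
      rw [card_insert_of_notMem h0n, card_image_of_injective _ hsinj, hcard] at hc
      exact (Nat.succ_injective hc).symm
  · intro W₁ h₁ W₂ h₂ h
    simp only at h
    rw [key W₁ h₁, key W₂ h₂, h]

theorem upIndicator_mem_orderVertices (p : P) : upIndicator p ∈ orderVertices P := by
  refine mem_orderVertices.2 ⟨fun q => ?_, fun q r hqr => ?_⟩
  · by_cases h : p ≤ q
    exacts [Or.inr (upIndicator_of_le h), Or.inl (upIndicator_of_not_le h)]
  · by_cases h : p ≤ q
    · rw [upIndicator_of_le h, upIndicator_of_le (h.trans hqr)]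
    · rw [upIndicator_of_not_le h]
      by_cases h' : p ≤ r
      · rw [upIndicator_of_le h']; exact zero_le_one
      · rw [upIndicator_of_not_le h']

/-- The system of indicators of principal up-sets is triangular. -/
theorem eq_zero_of_sum_upIndicator_eq_zero {S : Finset P} {w : P → ℝ}
    (h : ∑ p ∈ S, w p • upIndicator p = 0) : ∀ p ∈ S, w p = 0 := by
  intro p
  induction p using WellFoundedLT.induction with
  | ind p ih =>
    intro hp
    have h1 := congrFun h p
    rw [Finset.sum_apply, sum_eq_single_of_mem p hp] at h1
    · simpa [upIndicator_of_le (le_refl p)] using h1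
    · intro q hq hqp
      by_cases hle : q ≤ p
      · rw [ih q (lt_of_le_of_ne hle hqp) hq, zero_smul, Pi.zero_apply]
      · rw [Pi.smul_apply, upIndicator_of_not_le hle, smul_zero]

/-- The principal up-sets of the elements of a chain form, together with the empty up-set, the
vertices of a simplex face: the one on which each coordinate `q` agrees with the coordinate of the
greatest element of the chain below `q`, or with `0` if there is none. -/
theorem isSimplexVertexSet_upIndicator {S : Finset P} (hS : IsChain (· ≤ ·) (S : Set P)) :
    IsSimplexVertexSet (orderVertices P) (insert 0 (S.image upIndicator)) := by
  have h0n : (0 : P → ℝ) ∉ S.image upIndicator := by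
    simp only [mem_image, not_exists, not_and]
    exact fun p _ => upIndicator_ne_zero p
  constructor
  · have hWmem : ∀ x, x ∈ insert 0 (S.image upIndicator) ↔ x = 0 ∨ ∃ p ∈ S, upIndicator p = x :=
      fun x => by rw [mem_insert, mem_image]
    generalize insert 0 (S.image upIndicator) = W at hWmem
    have := Fintype.ofFinite P
    -- For each `q` one of the inequalities `0 ≤ x q` and `x m ≤ x q`, with `m` the greatest element
    -- of the chain below `q`, is made an equality; a sum of the functionals imposes them all.
    have hloc : ∀ q : P, ∃ g : (P → ℝ) →ₗ[ℝ] ℝ, ∀ x ∈ orderVertices P, g x ≤ 0 ∧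
        (g x = 0 ↔ (x q = 1 → ∃ s ∈ S, s ≤ q ∧ x s = 1)) := by
      intro q
      rcases (S.filter (· ≤ q)).eq_empty_or_nonempty with he | hne
      · refine ⟨-LinearMap.proj (R := ℝ) (φ := fun _ : P => ℝ) q, fun x hx => ?_⟩
        have hno : ¬ ∃ s ∈ S, s ≤ q ∧ x s = 1 := by
          rintro ⟨s, hs, hsq, -⟩
          have : s ∈ S.filter (· ≤ q) := mem_filter.2 ⟨hs, hsq⟩
          simp [he] at this
        change -x q ≤ 0 ∧ (-x q = 0 ↔ _)
        rcases (mem_orderVertices.1 hx).1 q with h | h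
        · simp [h]
        · simp [h, hno]
      · obtain ⟨m, hm⟩ := exists_maximal hne
        have hmS := mem_filter.1 hm.prop
        have hmax : ∀ s ∈ S, s ≤ q → s ≤ m := fun s hs hsq =>
          (hS.total hs hmS.1).elim id fun hms => hm.le_of_ge (mem_filter.2 ⟨hs, hsq⟩) hms
        refine ⟨LinearMap.proj (R := ℝ) (φ := fun _ : P => ℝ) m - LinearMap.proj q, fun x hx => ?_⟩
        obtain ⟨h01, hmono⟩ := mem_orderVertices.1 hx
        change x m - x q ≤ 0 ∧ (x m - x q = 0 ↔ _)
        have hmq := hmono hmS.2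
        refine ⟨sub_nonpos.2 hmq, ?_⟩
        constructor
        · intro heq hq
          exact ⟨m, hmS.1, hmS.2, by linarith⟩
        · intro himp
          rcases h01 q with hq | hq
          · rcases h01 m with hm0 | hm1
            · rw [hm0, hq, sub_zero]
            · rw [hm1, hq] at hmq
              norm_num at hmq
          · obtain ⟨s, hs, hsq, hxs⟩ := himp hq
            have := hmono (hmax s hs hsq)
            rw [hxs] at this
            rcases h01 m with hm0 | hm1
            · rw [hm0] at this
              norm_num at this
            · rw [hm1, hq, sub_self]
    choose g hg using hloc
    refine ⟨(∑ q, g q).toAffineMap, fun x hx => ?_, fun x => ?_⟩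
    · rw [LinearMap.coe_toAffineMap, LinearMap.sum_apply]
      exact sum_nonpos fun q _ => (hg q x hx).1
    · have hmem : x ∈ W → x ∈ orderVertices P := by
        intro hx
        rcases (hWmem x).1 hx with rfl | ⟨p, -, rfl⟩
        · exact zero_mem_orderVertices
        · exact upIndicator_mem_orderVertices p
      suffices hsuff : x ∈ orderVertices P → (x ∈ W ↔
          ∀ q, x q = 1 → ∃ s ∈ S, s ≤ q ∧ x s = 1) by
        have hz : x ∈ orderVertices P →
            ((∑ q, g q).toAffineMap x = 0 ↔ ∀ q, x q = 1 → ∃ s ∈ S, s ≤ q ∧ x s = 1) := by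
          intro hx
          rw [LinearMap.coe_toAffineMap, LinearMap.sum_apply,
            sum_eq_zero_iff_of_nonpos fun q _ => (hg q x hx).1]
          exact forall_congr' fun q => by simpa using (hg q x hx).2
        tauto
      intro hx
      obtain ⟨h01, hmono⟩ := mem_orderVertices.1 hx
      constructor
      · intro hxm q hq
        rcases (hWmem x).1 hxm with rfl | ⟨p, hp, rfl⟩
        · norm_num at hq
        · by_cases hpq : p ≤ q
          · exact ⟨p, hp, hpq, upIndicator_of_le le_rfl⟩
          · rw [upIndicator_of_not_le hpq] at hq
            norm_num at hq
      · intro hall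
        rcases (S.filter (fun s => x s = 1)).eq_empty_or_nonempty with he | hne
        · refine (hWmem x).2 (Or.inl (funext fun q => (h01 q).resolve_right fun hq => ?_))
          obtain ⟨s, hs, -, hxs⟩ := hall q hq
          have : s ∈ S.filter (fun s => x s = 1) := mem_filter.2 ⟨hs, hxs⟩
          simp [he] at this
        · obtain ⟨m, hm⟩ := exists_minimal hne
          have hmS := mem_filter.1 hm.prop
          refine (hWmem x).2 (Or.inr ⟨m, hmS.1, funext fun q => ?_⟩)
          by_cases hmq : m ≤ q
          · rw [upIndicator_of_le hmq]
            have := hmono hmq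
            rw [hmS.2] at this
            rcases h01 q with h | h
            · rw [h] at this
              norm_num at this
            · exact h.symm
          · rw [upIndicator_of_not_le hmq]
            refine ((h01 q).resolve_right fun hq => hmq ?_).symm
            obtain ⟨s, hs, hsq, hxs⟩ := hall q hq
            exact ((hS.total hmS.1 hs).elim id fun hsm =>
              hm.le_of_le (mem_filter.2 ⟨hs, hxs⟩) hsm).trans hsq
  · rw [affineIndependent_coe_finset_iff]
    intro w h0 h1
    rw [sum_insert h0n, sum_image upIndicator_injective.injOn] at h0 h1
    rw [smul_zero, zero_add] at h1
    have hw := eq_zero_of_sum_upIndicator_eq_zero (w := fun p => w (upIndicator p)) h1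
    rw [sum_eq_zero hw, add_zero] at h0
    intro x hx
    rcases mem_insert.1 hx with rfl | hx
    · exact h0
    · obtain ⟨p, hp, rfl⟩ := mem_image.1 hx
      exact hw p hp

theorem card_chainsOfCard_le_facesThrough_zero (n : ℕ) :
    #(chainsOfCard P n) ≤ #(facesThrough (orderVertices P) 0 n) := by
  have h0n : ∀ S : Finset P, (0 : P → ℝ) ∉ S.image upIndicator := by
    intro S
    simp only [mem_image, not_exists, not_and]
    exact fun p _ => upIndicator_ne_zero p
  refine card_le_card_of_injOn (fun S => insert 0 (S.image upIndicator)) ?_ ?_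
  · intro S hS
    rw [mem_coe, mem_chainsOfCard] at hS
    rw [mem_coe, mem_facesThrough]
    refine ⟨isSimplexVertexSet_upIndicator hS.1, ?_, mem_insert_self _ _⟩
    rw [card_insert_of_notMem (h0n S), card_image_of_injective _ upIndicator_injective, hS.2]
  · intro S _ T _ h
    have := congrArg (fun W : Finset (P → ℝ) => W.erase 0) h
    simp only [erase_insert (h0n _)] at this
    exact image_injective upIndicator_injective this

theorem card_chainsOfCard_le_facesThrough_one (n : ℕ) :
    #(chainsOfCard P n) ≤ #(facesThrough (orderVertices P) 1 n) := by
  -- The map `x ↦ 1 - x` exchanges the order polytopes of `P` and of its dual.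
  let f : (P → ℝ) →ᵃ[ℝ] (Pᵒᵈ → ℝ) := AffineMap.const ℝ (P → ℝ) (1 : Pᵒᵈ → ℝ) -
    (LinearMap.funLeft ℝ ℝ (OrderDual.ofDual : Pᵒᵈ → P)).toAffineMap
  have hf : ∀ x q, f x q = 1 - x (OrderDual.ofDual q) := fun _ _ => rfl
  have hbij : Set.BijOn f (orderVertices P) (orderVertices Pᵒᵈ) := by
    refine ⟨fun x hx => ?_, fun x _ y _ hxy => ?_, fun y hy => ?_⟩
    · rw [mem_coe, mem_orderVertices] at hx ⊢
      refine ⟨fun q => ?_, fun q r hqr => ?_⟩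
      · rw [hf]
        rcases hx.1 (OrderDual.ofDual q) with h | h <;> norm_num [h]
      · rw [hf, hf]
        exact sub_le_sub_left (hx.2 (OrderDual.ofDual_le_ofDual.2 hqr)) 1
    · ext p
      have := congrFun hxy (OrderDual.toDual p)
      rw [hf, hf] at this
      simpa using this
    · rw [mem_coe, mem_orderVertices] at hy
      refine ⟨fun p => 1 - y (OrderDual.toDual p), ?_, ?_⟩
      · rw [mem_coe, mem_orderVertices]
        refine ⟨fun q => ?_, fun q r hqr => ?_⟩
        · rcases hy.1 (OrderDual.toDual q) with h | h <;> norm_num [h]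
        · exact sub_le_sub_left (hy.2 (OrderDual.toDual_le_toDual.2 hqr)) 1
      · ext q
        rw [hf]
        simp
  have hf1 : f 1 = 0 := by
    ext q
    rw [hf]
    simp
  calc #(chainsOfCard P n) ≤ #(chainsOfCard Pᵒᵈ n) := by
        refine card_le_card_of_injOn (fun S => S.map OrderDual.toDual.toEmbedding) ?_
          (map_injective _).injOn
        intro S hS
        rw [mem_coe, mem_chainsOfCard] at hS ⊢
        refine ⟨?_, by rw [card_map, hS.2]⟩
        intro p hp q hq hpq
        rw [mem_coe, mem_map] at hp hq
        obtain ⟨p, hp, rfl⟩ := hp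
        obtain ⟨q, hq, rfl⟩ := hq
        exact (hS.1.total hp hq).symm
    _ ≤ #(facesThrough (orderVertices Pᵒᵈ) 0 n) := card_chainsOfCard_le_facesThrough_zero n
    _ ≤ #(facesThrough (orderVertices P) 1 n) := by
        rw [← hf1]
        exact card_facesThrough_le_of_bijOn f hbij one_mem_orderVertices n

end FacesThroughVertices

section FaceCounts

/-! ### Vertices of the polytopes of disjoint unions and ordinal sums -/

theorem card_simplexFaces_eq_of_affineEquiv {E F : Type*} [AddCommGroup E] [Module ℝ E]
    [AddCommGroup F] [Module ℝ F] {V : Finset E} {V' : Finset F} (e : E ≃ₗ[ℝ] F)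
    (h : ∀ x, x ∈ V ↔ e x ∈ V') (n : ℕ) : #(simplexFaces V n) = #(simplexFaces V' n) := by
  refine le_antisymm (card_simplexFaces_le_of_bijOn e.symm.toLinearMap.toAffineMap ?_ n)
    (card_simplexFaces_le_of_bijOn e.toLinearMap.toAffineMap ?_ n)
  · refine ⟨fun y hy => ?_, e.symm.injective.injOn, fun x hx => ?_⟩
    · change e.symm y ∈ V
      rw [h, e.apply_symm_apply]
      exact hy
    · exact ⟨e x, (h x).1 hx, e.symm_apply_apply x⟩
  · refine ⟨fun x hx => (h x).1 hx, e.injective.injOn, fun y hy => ?_⟩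
    refine ⟨e.symm y, ?_, e.apply_symm_apply y⟩
    rw [mem_coe, h, e.apply_symm_apply]
    exact hy

theorem card_simplexFaces_orderVertices_of_orderIso {A B : Type*} [PartialOrder A]
    [PartialOrder B] [Finite A] [Finite B] (e : A ≃o B) (n : ℕ) :
    #(simplexFaces (orderVertices B) n) = #(simplexFaces (orderVertices A) n) := by
  refine card_simplexFaces_eq_of_affineEquiv (LinearEquiv.funCongrLeft ℝ ℝ e.toEquiv)
    (fun x => ?_) n
  rw [mem_orderVertices, mem_orderVertices]
  refine and_congr (e.surjective.forall (p := fun q => x q = 0 ∨ x q = 1))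
    ⟨fun h => h.comp e.monotone, fun h p q hpq => ?_⟩
  have := h (e.symm.monotone hpq)
  simpa [LinearEquiv.funCongrLeft_apply, LinearMap.funLeft_apply] using this

theorem card_simplexFaces_chainVertices_of_orderIso {A B : Type*} [PartialOrder A]
    [PartialOrder B] [Finite A] [Finite B] (e : A ≃o B) (n : ℕ) :
    #(simplexFaces (chainVertices B) n) = #(simplexFaces (chainVertices A) n) := by
  refine card_simplexFaces_eq_of_affineEquiv (LinearEquiv.funCongrLeft ℝ ℝ e.toEquiv)
    (fun x => ?_) n
  rw [mem_chainVertices, mem_chainVertices]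
  refine and_congr (e.surjective.forall (p := fun q => x q = 0 ∨ x q = 1))
    ⟨fun h p q hpq => h _ _ (e.strictMono hpq), fun h p q hpq => ?_⟩
  have := h _ _ (e.symm.strictMono hpq)
  simpa [LinearEquiv.funCongrLeft_apply, LinearMap.funLeft_apply] using this

variable {A B : Type*} [PartialOrder A] [PartialOrder B] [Finite A] [Finite B]

theorem card_simplexFaces_orderVertices_sum (n : ℕ) :
    #(simplexFaces (orderVertices (A ⊕ B)) n) =
      #(simplexFaces (orderVertices A ×ˢ orderVertices B) n) := by
  refine card_simplexFaces_eq_of_affineEquiv (LinearEquiv.sumArrowLequivProdArrow A B ℝ ℝ)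
    (fun x => ?_) n
  obtain ⟨y, z, rfl⟩ : ∃ y z, x = Sum.elim y z :=
    ⟨x ∘ Sum.inl, x ∘ Sum.inr, (Sum.elim_comp_inl_inr x).symm⟩
  change _ ↔ (y, z) ∈ _
  simp only [mem_product, mem_orderVertices, Sum.forall, Sum.elim_inl, Sum.elim_inr, Monotone,
    Sum.inl_le_inl_iff, Sum.inr_le_inr_iff, Sum.not_inl_le_inr, Sum.not_inr_le_inl]
  constructor
  · rintro ⟨⟨h1, h2⟩, h3, h4⟩
    exact ⟨⟨h1, fun p => (h3 p).1⟩, h2, fun p => (h4 p).2⟩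
  · rintro ⟨⟨h1, h2⟩, h3, h4⟩
    exact ⟨⟨h1, h3⟩, fun p => ⟨@h2 p, fun _ h => h.elim⟩, fun p => ⟨fun _ h => h.elim, @h4 p⟩⟩

theorem card_simplexFaces_chainVertices_sum (n : ℕ) :
    #(simplexFaces (chainVertices (A ⊕ B)) n) =
      #(simplexFaces (chainVertices A ×ˢ chainVertices B) n) := by
  refine card_simplexFaces_eq_of_affineEquiv (LinearEquiv.sumArrowLequivProdArrow A B ℝ ℝ)
    (fun x => ?_) n
  obtain ⟨y, z, rfl⟩ : ∃ y z, x = Sum.elim y z :=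
    ⟨x ∘ Sum.inl, x ∘ Sum.inr, (Sum.elim_comp_inl_inr x).symm⟩
  change _ ↔ (y, z) ∈ _
  simp only [mem_product, mem_chainVertices, Sum.forall, Sum.elim_inl, Sum.elim_inr,
    Sum.inl_lt_inl_iff, Sum.inr_lt_inr_iff, Sum.not_inl_lt_inr, Sum.not_inr_lt_inl]
  constructor
  · rintro ⟨⟨h1, h2⟩, h3, h4⟩
    exact ⟨⟨h1, fun p => (h3 p).1⟩, h2, fun p => (h4 p).2⟩
  · rintro ⟨⟨h1, h2⟩, h3, h4⟩
    exact ⟨⟨h1, h3⟩, fun p => ⟨h2 p, fun _ h => h.elim⟩, fun p => ⟨fun _ h => h.elim, h4 p⟩⟩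

instance (A B : Type*) [Finite A] [Finite B] : Finite (A ⊕ₗ B) :=
  inferInstanceAs (Finite (A ⊕ B))

/-- The coordinates on the two parts of an ordinal sum. -/
def lexFunctionEquiv (A B : Type*) : (Lex (A ⊕ B) → ℝ) ≃ₗ[ℝ] (A → ℝ) × (B → ℝ) :=
  (LinearEquiv.funCongrLeft ℝ ℝ (toLex : A ⊕ B ≃ Lex (A ⊕ B))).trans
    (LinearEquiv.sumArrowLequivProdArrow A B ℝ ℝ)

/-- An up-set of an ordinal sum is empty on the lower part or everything on the upper part. -/
theorem card_simplexFaces_orderVertices_lex (n : ℕ) :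
    #(simplexFaces (orderVertices (A ⊕ₗ B)) n) =
      #(simplexFaces (wedge 0 1 (orderVertices A) (orderVertices B)) n) := by
  refine card_simplexFaces_eq_of_affineEquiv (lexFunctionEquiv A B) (fun x => ?_) n
  obtain ⟨y, z, rfl⟩ : ∃ y z, x = Sum.elim y z ∘ ofLex :=
    ⟨fun a => x (toLex (Sum.inl a)), fun b => x (toLex (Sum.inr b)), by
      ext p
      induction p using Lex.rec with
      | h p => cases p <;> rfl⟩
  change _ ↔ (y, z) ∈ _
  simp only [mem_wedge, mem_orderVertices, Lex.forall, Sum.forall, Function.comp_apply,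
    ofLex_toLex, Sum.elim_inl, Sum.elim_inr, Monotone, Sum.Lex.inl_le_inl_iff,
    Sum.Lex.inr_le_inr_iff, Sum.Lex.inl_le_inr, Sum.Lex.not_inr_le_inl]
  constructor
  · rintro ⟨⟨h1, h2⟩, h3, h4⟩
    by_cases hz : ∀ b, z b = 1
    · exact Or.inl ⟨⟨h1, fun a a' => (h3 a).1 a'⟩, funext hz⟩
    · push Not at hz
      obtain ⟨b, hb⟩ := hz
      have hb0 := (h2 b).resolve_right hb
      refine Or.inr ⟨funext fun a => (h1 a).resolve_right fun ha => ?_, h2, fun b b' => (h4 b).2 b'⟩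
      have := (h3 a).2 b trivial
      rw [ha, hb0] at this
      norm_num at this
  · rintro (⟨⟨h1, h2⟩, rfl⟩ | ⟨rfl, h1, h2⟩)
    · refine ⟨⟨h1, fun _ => Or.inr rfl⟩, fun a => ⟨fun a' => @h2 a a', fun b _ => ?_⟩,
        fun b => ⟨fun _ h => h.elim, fun _ _ => le_rfl⟩⟩
      rcases h1 a with h | h <;> norm_num [h]
    · refine ⟨⟨fun _ => Or.inl rfl, h1⟩, fun a => ⟨fun _ _ => le_rfl, fun b _ => ?_⟩,
        fun b => ⟨fun _ h => h.elim, fun b' => @h2 b b'⟩⟩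
      rcases h1 b with h | h <;> norm_num [h]

/-- An antichain of an ordinal sum lies in one of the two parts. -/
theorem card_simplexFaces_chainVertices_lex (n : ℕ) :
    #(simplexFaces (chainVertices (A ⊕ₗ B)) n) =
      #(simplexFaces (wedge 0 0 (chainVertices A) (chainVertices B)) n) := by
  refine card_simplexFaces_eq_of_affineEquiv (lexFunctionEquiv A B) (fun x => ?_) n
  obtain ⟨y, z, rfl⟩ : ∃ y z, x = Sum.elim y z ∘ ofLex :=
    ⟨fun a => x (toLex (Sum.inl a)), fun b => x (toLex (Sum.inr b)), by
      ext p
      induction p using Lex.rec with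
      | h p => cases p <;> rfl⟩
  change _ ↔ (y, z) ∈ _
  simp only [mem_wedge, mem_chainVertices, Lex.forall, Sum.forall, Function.comp_apply,
    ofLex_toLex, Sum.elim_inl, Sum.elim_inr, Sum.Lex.inl_lt_inl_iff,
    Sum.Lex.inr_lt_inr_iff, Sum.Lex.inl_lt_inr, Sum.Lex.not_inr_lt_inl]
  constructor
  · rintro ⟨⟨h1, h2⟩, h3, h4⟩
    by_cases hz : ∀ b, z b = 0
    · exact Or.inl ⟨⟨h1, fun a a' => (h3 a).1 a'⟩, funext hz⟩
    · push Not at hz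
      obtain ⟨b, hb⟩ := hz
      exact Or.inr ⟨funext fun a => ((h3 a).2 b trivial).resolve_right hb, h2,
        fun b b' => (h4 b).2 b'⟩
  · rintro (⟨⟨h1, h2⟩, rfl⟩ | ⟨rfl, h1, h2⟩)
    · exact ⟨⟨h1, fun _ => Or.inl rfl⟩, fun a => ⟨h2 a, fun b _ => Or.inr rfl⟩,
        fun b => ⟨fun _ h => h.elim, fun _ _ => Or.inl rfl⟩⟩
    · exact ⟨⟨fun _ => Or.inl rfl, h1⟩, fun a => ⟨fun _ _ => Or.inl rfl, fun b _ => Or.inl rfl⟩,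
        fun b => ⟨fun _ h => h.elim, h2 b⟩⟩

/-! ### Comparison of the face numbers -/

/-- Replacing one of two polytopes that are glued at a vertex by one with more simplex faces, but
with fewer of them through the vertex, does not decrease the number of simplex faces. -/
theorem sum_antidiagonal_mul_le {α α' γ γ' β β' : ℕ → ℕ} (h0 : α 0 ≤ γ 0)
    (h : ∀ i, α (i + 1) + α' i ≤ γ (i + 1) + γ' i) (hα : ∀ i, γ' i ≤ α' i)
    (hβ : ∀ j, β' j ≤ β j) (n : ℕ) :
    ∑ p ∈ antidiagonal (n + 1), α p.1 * β p.2 + ∑ p ∈ antidiagonal n, α' p.1 * β' p.2 ≤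
      ∑ p ∈ antidiagonal (n + 1), γ p.1 * β p.2 + ∑ p ∈ antidiagonal n, γ' p.1 * β' p.2 := by
  rw [Nat.sum_antidiagonal_succ, Nat.sum_antidiagonal_succ, add_assoc, add_assoc,
    ← sum_add_distrib, ← sum_add_distrib]
  refine add_le_add (Nat.mul_le_mul_right _ h0) (sum_le_sum fun p _ => ?_)
  -- `(γ - α) β ≥ (α' - γ') β ≥ (α' - γ') β'`
  obtain ⟨d, hd⟩ := Nat.exists_eq_add_of_le (hα p.1)
  have h1 := h p.1
  have h2 : α (p.1 + 1) + d ≤ γ (p.1 + 1) := by omega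
  calc α (p.1 + 1) * β p.2 + α' p.1 * β' p.2
      = α (p.1 + 1) * β p.2 + d * β' p.2 + γ' p.1 * β' p.2 := by rw [hd]; ring
    _ ≤ α (p.1 + 1) * β p.2 + d * β p.2 + γ' p.1 * β' p.2 := by
        gcongr
        exact hβ _
    _ = (α (p.1 + 1) + d) * β p.2 + γ' p.1 * β' p.2 := by ring
    _ ≤ γ (p.1 + 1) * β p.2 + γ' p.1 * β' p.2 := by gcongr

/-- The comparison of glued polytopes for simplex faces, one summand at a time. -/
theorem card_simplexFaces_wedge_le_left {E E' F : Type*} [AddCommGroup E] [Module ℝ E]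
    [AddCommGroup E'] [Module ℝ E'] [AddCommGroup F] [Module ℝ F] {V : Finset E} {V' : Finset E'}
    {U : Finset F} {u : E} {u' : E'} {v : F} (hu : u ∈ V) (hu' : u' ∈ V') (hv : v ∈ U)
    (h : ∀ n, #(simplexFaces V (n + 1)) ≤ #(simplexFaces V' (n + 1)))
    (h' : ∀ n, #(facesThrough V' u' n) ≤ #(facesThrough V u n)) (n : ℕ) :
    #(simplexFaces (wedge u v V U) (n + 1)) ≤ #(simplexFaces (wedge u' v V' U) (n + 1)) := by
  rw [card_simplexFaces_succ _ (u, v), card_simplexFaces_succ _ (u', v),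
    card_facesAvoiding_wedge hu hv, card_facesAvoiding_wedge hu' hv,
    card_facesThrough_wedge hu hv, card_facesThrough_wedge hu' hv]
  refine sum_antidiagonal_mul_le (α := fun i => #(facesAvoiding V u i))
    (α' := fun i => #(facesThrough V u i)) (γ := fun i => #(facesAvoiding V' u' i))
    (γ' := fun i => #(facesThrough V' u' i)) (by simp only [card_facesAvoiding_zero, le_refl])
    (fun i => ?_) h' (card_facesThrough_le_card_facesAvoiding U v) n
  rw [← card_simplexFaces_succ, ← card_simplexFaces_succ]
  exact h i

theorem card_simplexFaces_wedge_swap {E F : Type*} [AddCommGroup E] [Module ℝ E]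
    [AddCommGroup F] [Module ℝ F] (V : Finset E) (U : Finset F) (u : E) (v : F) (n : ℕ) :
    #(simplexFaces (wedge u v V U) n) = #(simplexFaces (wedge v u U V) n) := by
  refine card_simplexFaces_eq_of_affineEquiv (LinearEquiv.prodComm ℝ E F) (fun p => ?_) n
  rw [LinearEquiv.prodComm_apply, mem_wedge, mem_wedge, Prod.fst_swap, Prod.snd_swap]
  tauto

/-- The polytopes of an ordinal sum are glued from those of the summands, at the vertices `0` and
`1` of the order polytopes and at the origins of the chain polytopes. Through those vertices the
order polytope has at least as many simplex faces as there are chains in the poset, and the chain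
polytope has at most that many. -/
theorem card_simplexFaces_lex_le
    (hA : ∀ n, #(simplexFaces (orderVertices A) (n + 1)) ≤
      #(simplexFaces (chainVertices A) (n + 1)))
    (hB : ∀ n, #(simplexFaces (orderVertices B) (n + 1)) ≤
      #(simplexFaces (chainVertices B) (n + 1)))
    (n : ℕ) : #(simplexFaces (orderVertices (A ⊕ₗ B)) (n + 1)) ≤
      #(simplexFaces (chainVertices (A ⊕ₗ B)) (n + 1)) := by
  rw [card_simplexFaces_orderVertices_lex, card_simplexFaces_chainVertices_lex]
  calc #(simplexFaces (wedge 0 1 (orderVertices A) (orderVertices B)) (n + 1))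
      ≤ #(simplexFaces (wedge 0 1 (chainVertices A) (orderVertices B)) (n + 1)) :=
        card_simplexFaces_wedge_le_left zero_mem_orderVertices zero_mem_chainVertices
          one_mem_orderVertices hA (fun n => (card_facesThrough_chainVertices_le n).trans
            (card_chainsOfCard_le_facesThrough_zero n)) n
    _ = #(simplexFaces (wedge 1 0 (orderVertices B) (chainVertices A)) (n + 1)) :=
        card_simplexFaces_wedge_swap _ _ _ _ _
    _ ≤ #(simplexFaces (wedge 0 0 (chainVertices B) (chainVertices A)) (n + 1)) :=
        card_simplexFaces_wedge_le_left one_mem_orderVertices zero_mem_chainVertices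
          zero_mem_chainVertices hB (fun n => (card_facesThrough_chainVertices_le n).trans
            (card_chainsOfCard_le_facesThrough_one n)) n
    _ = #(simplexFaces (wedge 0 0 (chainVertices A) (chainVertices B)) (n + 1)) :=
        card_simplexFaces_wedge_swap _ _ _ _ _

theorem card_simplexFaces_sum_le
    (hA : ∀ n, #(simplexFaces (orderVertices A) (n + 1)) ≤
      #(simplexFaces (chainVertices A) (n + 1)))
    (hB : ∀ n, #(simplexFaces (orderVertices B) (n + 1)) ≤
      #(simplexFaces (chainVertices B) (n + 1)))
    (n : ℕ) : #(simplexFaces (orderVertices (A ⊕ B)) (n + 1)) ≤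
      #(simplexFaces (chainVertices (A ⊕ B)) (n + 1)) := by
  rw [card_simplexFaces_orderVertices_sum, card_simplexFaces_chainVertices_sum,
    card_simplexFaces_product, card_simplexFaces_product]
  refine sum_le_sum fun p hp => ?_
  simp only [mem_insert, mem_singleton] at hp
  rcases hp with rfl | rfl
  exacts [Nat.mul_le_mul (hA n) (hB 0), Nat.mul_le_mul (hA 0) (hB n)]

end FaceCounts

theorem XFamily.finite {P : Type u} [PartialOrder P] (hP : XFamily P) : Finite P := by
  induction hP with
  | of_xFree _ => assumption
  | disjointUnion _ _ hA hB => exact inferInstance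
  | ordinalSum _ _ hA hB => exact inferInstance
  | of_orderIso e _ hA => exact Finite.of_equiv _ e.toEquiv

theorem XFamily.card_simplexFaces_le {P : Type u} [PartialOrder P] (hP : XFamily P) :
    ∀ [Finite P] (n : ℕ), #(simplexFaces (orderVertices P) (n + 1)) ≤
      #(simplexFaces (chainVertices P) (n + 1)) := by
  induction hP with
  | of_xFree h => exact fun n => h.card_simplexFaces_le (n + 1)
  | disjointUnion hA hB ihA ihB =>
    have := hA.finite
    have := hB.finite
    exact fun _ n => card_simplexFaces_sum_le ihA ihB n
  | ordinalSum hA hB ihA ihB =>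
    have := hA.finite
    have := hB.finite
    exact fun _ n => card_simplexFaces_lex_le ihA ihB n
  | of_orderIso e hA ih =>
    have := hA.finite
    intro _ n
    rw [card_simplexFaces_orderVertices_of_orderIso e,
      card_simplexFaces_chainVertices_of_orderIso e]
    exact ih n

theorem theorem4p1 (P : Type u) [PartialOrder P] (hP : XFamily P) (k : ℕ) :
    simplexFaceCount (orderPolytope P) k ≤ simplexFaceCount (chainPolytope P) k := by
  have := hP.finite
  rw [simplexFaceCount_orderPolytope, simplexFaceCount_chainPolytope]
  exact_mod_cast hP.card_simplexFaces_le k
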